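/- All logarithms are to base 2 and information is measured in bits. Let $\mathcal X,\mathcal Y$ be Polish spaces with their Borel $\sigma$-algebras (not necessarily discrete), let $\mathrm P_X$ be a probability measure on $\mathcal X$ and $\mathrm P_{Y|X}$ a channel (Markov kernel) from $\mathcal X$ to $\mathcal Y$, and let $(X,Y)\sim \mathrm P_X\mathrm P_{Y|X}$, with mutual information $I(X;Y)=D(\mathrm P_{XY}\,\|\,\mathrm P_X\times \mathrm P_Y)$. A one-shot simulation scheme consists of a random variable $W$ (the common randomness, shared by Alice and Bob) with values in a standard Borel space $\mathcal W$ and independent of $X$, a measurable encoder $M=f(X,W)\in\{0,1\}^*$ such that for every $w\in\mathcal W$ the set of descriptions $\{f(x,w):x\in\mathcal X\}$ is prefix-free, and a measurable decoder $\hat Y=h(M,W)\in\mathcal Y$. It is exact if $(X,\hat Y)$ has the law $\mathrm P_X\mathrm P_{Y|X}$. Let $L(M)$ be the length of $M$. (1) If $I(X;Y)<\infty$, then there is an exact one-shot simulation scheme with $$\mathbb E[L(M)]\le I(X;Y)+\log(I(X;Y)+1)+5 .$$ (2) If $\mathcal X$ and $\mathcal Y$ are finite (discrete), then $I(X;Y)<\infty$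 and there is an exact one-shot simulation scheme that satisfies the same bound on $\mathbb E[L(M)]$ and whose common randomness takes values in a finite set $\mathcal W$ with $$\log|\mathcal W|\le \log\bigl(|\mathcal X|(|\mathcal Y|-1)+2\bigr).$$ -/

import Mathlib

open MeasureTheory ProbabilityTheory
open scoped ENNReal

/-- The mutual information `I(X;Y) = D(P_{XY} ‖ P_X × P_Y)` of a joint law `P` of `(X, Y)`, in nats
and with values in `[0, ∞]`. -/
noncomputable def mutualInfo {𝓧 𝓨 : Type*} [MeasurableSpace 𝓧] [MeasurableSpace 𝓨]
    (P : Measure (𝓧 × 𝓨)) : ℝ≥0∞ :=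
  InformationTheory.klDiv P (P.fst.prod P.snd)

/-- The mutual information in bits, as a real number; it is meaningful when `mutualInfo P ≠ ∞`. -/
noncomputable def mutualInfoBits {𝓧 𝓨 : Type*} [MeasurableSpace 𝓧] [MeasurableSpace 𝓨]
    (P : Measure (𝓧 × 𝓨)) : ℝ :=
  (mutualInfo P).toReal / Real.log 2

/-- A set of binary strings is prefix-free if no member is a proper prefix of another member. -/
def IsPrefixFree (C : Set (List Bool)) : Prop :=
  ∀ a ∈ C, ∀ b ∈ C, a <+: b → a = b

/-- A one-shot scheme for simulating a channel from `𝓧` to `𝓨` with common randomness in `𝓦`.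
Alice and Bob share `W ∼ law`, which is independent of the input `X`. Alice sends the binary
description `M = enc X W`, Bob outputs `dec M W`. As `W` is known on both sides, the code may depend
on the value `w` of `W`; for each `w` the set of possible descriptions is prefix-free.
There is no private randomness. -/
structure SimulationScheme (𝓧 𝓨 𝓦 : Type*) [MeasurableSpace 𝓧] [MeasurableSpace 𝓨]
    [MeasurableSpace 𝓦] where
  /-- the law of the common randomness -/
  law : Measure 𝓦
  isProbabilityMeasure_law : IsProbabilityMeasure law
  /-- Alice's encoder -/
  enc : 𝓧 → 𝓦 → List Bool
  /-- Bob's decoder -/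
  dec : List Bool → 𝓦 → 𝓨
  measurableSet_enc : ∀ m : List Bool, MeasurableSet {p : 𝓧 × 𝓦 | enc p.1 p.2 = m}
  measurable_dec : ∀ m : List Bool, Measurable (dec m)
  prefixFree : ∀ w : 𝓦, IsPrefixFree (Set.range fun x => enc x w)

namespace SimulationScheme

variable {𝓧 𝓨 𝓦 : Type*} [MeasurableSpace 𝓧] [MeasurableSpace 𝓨] [MeasurableSpace 𝓦]

/-- The joint law of the input `X ∼ μ` and Bob's output, with `W` independent of `X`. -/
noncomputable def jointLaw (S : SimulationScheme 𝓧 𝓨 𝓦) (μ : Measure 𝓧) : Measure (𝓧 × 𝓨) :=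
  (μ.prod S.law).map fun p => (p.1, S.dec (S.enc p.1 p.2) p.2)

/-- The scheme simulates the channel `κ` exactly on the input `X ∼ μ`: the pair of the input and
Bob's output has the law `P_X P_{Y|X}`. -/
def Simulates (S : SimulationScheme 𝓧 𝓨 𝓦) (μ : Measure 𝓧) (κ : Kernel 𝓧 𝓨) : Prop :=
  S.jointLaw μ = μ.compProd κ

/-- The expected length `E[L(M)]` of the description, in bits. -/
noncomputable def expectedLength (S : SimulationScheme 𝓧 𝓨 𝓦) (μ : Measure 𝓧) : ℝ≥0∞ :=
  ∫⁻ p, ((S.enc p.1 p.2).length : ℝ≥0∞) ∂(μ.prod S.law)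

/-- The map used in `jointLaw` is measurable, so that the push-forward there is the actual law. -/
theorem measurable_output (S : SimulationScheme 𝓧 𝓨 𝓦) :
    Measurable fun p : 𝓧 × 𝓦 => (p.1, S.dec (S.enc p.1 p.2) p.2) := by
  refine measurable_fst.prodMk ?_
  intro A hA
  have h : (fun p : 𝓧 × 𝓦 => S.dec (S.enc p.1 p.2) p.2) ⁻¹' A =
      ⋃ m : List Bool, ({p : 𝓧 × 𝓦 | S.enc p.1 p.2 = m} ∩ {p : 𝓧 × 𝓦 | S.dec m p.2 ∈ A}) := by
    ext p
    simp
  rw [h]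
  exact MeasurableSet.iUnion fun m =>
    (S.measurableSet_enc m).inter (((S.measurable_dec m).comp measurable_snd) hA)

end SimulationScheme

/-! The common randomness is an i.i.d. sequence of proposals from ν = P_Y, each with a uniform
variable. Given x, with f = dP_{Y|X=x}/dν, Alice finds the first accepted proposal and sends its
index K in a prefix code; Bob outputs that proposal.

The rejection sampler raises a level l_k, with survival probability s_k = ∫ (f - l_k)₊ dν. Round k
accepts the density min((f - l_k)₊, s_{k+1}), where the next level solves the implicit equation
l_{k+1} = l_k + s_{k+1} (`nextLevel_eq`). As s_{k+1} ≤ s_k this is a legal acceptance rule, and s_k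
→ 0 makes the output exact (`tsum_setLIntegral_acc`).

The implicit choice drives the bound E log(K + 3/2) ≤ D + 2 log 2 in nats (`tsum_acc_mul_log_le`), D
being the divergence of f. Abel summation and a telescoping potential reduce the left side to ∑
s_{k+1} log((l_{k+1}+a)/(l_k+a)). Since s_{k+1} = ∫ (f - l_{k+1})₊, the integrand in y is a lower
Riemann sum of (f - t)/(t + a), and its integral is compared with D by the log-sum inequality.

Kraft's converse for the power law s(k+3/2)^(-1-s) gives length at most 1 - log s + (1+s)
log(k+3/2). Averaging over x with s = 1/(I+2) gives the claim.

For finite alphabets, w acts only through the function x ↦ ŷ and the mean length. Carathéodory's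
theorem in dimension |𝓧|(|𝓨|-1)+1 keeps few values of w (`SimulationScheme.exists_reindex`). -/

/-! ### Real inequalities for the mean logarithm of the index -/

/-- A survival sequence `s` whose partial sums are `l` has its logarithmic mean index controlled by
the levels `l`. -/
lemma sum_sub_mul_log_le {s l : ℕ → ℝ} (hs0 : s 0 = 1) (hs : ∀ k, 0 ≤ s k) (hl0 : l 0 = 0)
    (hl : ∀ k, l (k + 1) = l k + s (k + 1)) {a : ℝ} (ha : 0 < a) (N : ℕ) :
    ∑ k ∈ Finset.range N, (s k - s (k + 1)) * Real.log (k + 3 / 2) ≤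
      Real.log (3 / 2) + a / (3 / 2) +
        ∑ k ∈ Finset.range N, s (k + 1) * Real.log ((l (k + 1) + a) / (l k + a)) := by
  have hlnn : ∀ k, 0 ≤ l k := by
    intro k
    induction k with
    | zero => rw [hl0]
    | succ k ih => rw [hl]; linarith [hs (k + 1)]
  -- The boundary terms of the Abel summation and of the telescoping potential are kept so that the
  -- induction closes; both are nonnegative.
  have key : ∑ k ∈ Finset.range N, (s k - s (k + 1)) * Real.log (k + 3 / 2)
      + s N * Real.log (N + 3 / 2) + (l N + a) / (N + 3 / 2) ≤
      Real.log (3 / 2) + a / (3 / 2) +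
        ∑ k ∈ Finset.range N, s (k + 1) * Real.log ((l (k + 1) + a) / (l k + a)) := by
    induction N with
    | zero => simp [hs0, hl0]
    | succ N ih =>
      rw [Finset.sum_range_succ, Finset.sum_range_succ]
      have hg : (0 : ℝ) < N + 3 / 2 := by positivity
      have hg' : (0 : ℝ) < N + 1 + 3 / 2 := by positivity
      have hv : 0 < l N + a := by linarith [hlnn N]
      have hv' : 0 < l (N + 1) + a := by linarith [hlnn (N + 1)]
      -- The potential `v` is a running average of the survival sequence, started with mass `a` on
      -- weight 3/2. Its update (`e3`) and log x ≤ x - 1 leave only a negative square as error.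
      have h1 : s (N + 1) * (Real.log ((l N + a) / (N + 3 / 2))
          - Real.log ((l (N + 1) + a) / (N + 1 + 3 / 2))) ≤
          (l N + a) / (N + 3 / 2) - (l (N + 1) + a) / (N + 1 + 3 / 2) := by
        set v := (l N + a) / (N + 3 / 2) with hvdef
        set v' := (l (N + 1) + a) / (N + 1 + 3 / 2) with hvdef'
        have hvp : 0 < v := by positivity
        have hvp' : 0 < v' := by positivity
        have e1 : v * (N + 3 / 2) = l N + a := by rw [hvdef]; field_simp
        have e2 : v' * (N + 1 + 3 / 2) = l (N + 1) + a := by rw [hvdef']; field_simp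
        have e3 : s (N + 1) - v' = (v' - v) * (N + 3 / 2) := by
          have := hl N
          linarith
        rw [← Real.log_div hvp.ne' hvp'.ne']
        have h2 : Real.log (v / v') ≤ v / v' - 1 := Real.log_le_sub_one_of_pos (by positivity)
        calc s (N + 1) * Real.log (v / v') ≤ s (N + 1) * (v / v' - 1) :=
              mul_le_mul_of_nonneg_left h2 (hs _)
          _ = (v - v') - (v - v') ^ 2 * (N + 3 / 2) / v' := by
              have e4 : s (N + 1) = v' + (v' - v) * (N + 3 / 2) := by linarith
              rw [e4]; field_simp; ring
          _ ≤ v - v' := by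
              have : 0 ≤ (v - v') ^ 2 * (N + 3 / 2) / v' := by positivity
              linarith
      rw [Real.log_div hv.ne' hg.ne', Real.log_div hv'.ne' hg'.ne'] at h1
      rw [Real.log_div hv'.ne' hv.ne']
      push_cast
      linarith
  have h1 : 0 ≤ s N * Real.log (N + 3 / 2) :=
    mul_nonneg (hs N) (Real.log_nonneg (by linarith [(Nat.cast_nonneg N : (0 : ℝ) ≤ N)]))
  have h2 : 0 ≤ (l N + a) / (N + 3 / 2) :=
    div_nonneg (by linarith [hlnn N]) (by positivity)
  linarith

lemma sub_le_mul_log_div {a u t : ℝ} (hu : 0 < u + a) (ht : 0 < t + a) :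
    t - u ≤ (t + a) * Real.log ((t + a) / (u + a)) := by
  have h := Real.one_sub_inv_le_log_of_pos (show 0 < (t + a) / (u + a) by positivity)
  calc t - u = (t + a) * (1 - ((t + a) / (u + a))⁻¹) := by field_simp; ring
    _ ≤ _ := mul_le_mul_of_nonneg_left h ht.le

/-- The right side is ∫₀^f (f - t)/(t + a) dt. On each cell the decreasing factor f - t is taken at
the right endpoint, so the sum is a lower sum, whatever the mesh; cells ending beyond f contribute
0. -/
lemma sum_max_mul_log_le {l : ℕ → ℝ} (hl0 : l 0 = 0) (hl : Monotone l) {a f : ℝ} (ha : 0 < a)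
    (hf : 0 ≤ f) (N : ℕ) :
    ∑ k ∈ Finset.range N, max (f - l (k + 1)) 0 * Real.log ((l (k + 1) + a) / (l k + a)) ≤
      (f + a) * Real.log ((f + a) / a) - f := by
  have hlnn : ∀ k, 0 ≤ l k := fun k => hl0 ▸ hl (Nat.zero_le k)
  have mono : ∀ u t : ℝ, 0 ≤ u → u ≤ t → t ≤ f →
      (f - t) * Real.log ((t + a) / (u + a)) ≤
      ((f + a) * Real.log ((t + a) / a) - t) - ((f + a) * Real.log ((u + a) / a) - u) := by
    intro u t hu hut htf
    have h := sub_le_mul_log_div (a := a) (u := u) (t := t) (by linarith) (by linarith)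
    rw [Real.log_div (by linarith) (by linarith)] at *
    rw [Real.log_div (by linarith) (by linarith), Real.log_div (by linarith) (by linarith)]
    linarith
  have lognn : ∀ u t : ℝ, 0 ≤ u → u ≤ t → 0 ≤ Real.log ((t + a) / (u + a)) := by
    intro u t hu hut
    exact Real.log_nonneg ((one_le_div (by linarith)).2 (by linarith))
  have key : ∑ k ∈ Finset.range N,
      max (f - l (k + 1)) 0 * Real.log ((l (k + 1) + a) / (l k + a)) ≤
      (f + a) * Real.log ((min (l N) f + a) / a) - min (l N) f := by
    induction N with
    | zero => simp [hl0, hf, ha.ne']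
    | succ N ih =>
      rw [Finset.sum_range_succ]
      have hm := hl (Nat.le_succ N)
      have hm0 : 0 ≤ min (l N) f := le_min (hlnn N) hf
      rcases le_total (l (N + 1)) f with h | h
      · have h3 := mono (l N) (l (N + 1)) (hlnn N) hm h
        rw [min_eq_left h, max_eq_left (by linarith)]
        rw [min_eq_left (hm.trans h)] at ih
        linarith
      · rw [min_eq_right h, max_eq_right (by linarith), zero_mul]
        have h3 := mono (min (l N) f) f hm0 (min_le_right _ _) le_rfl
        rw [sub_self, zero_mul] at h3
        linarith
  refine key.trans ?_
  have hm0 : 0 ≤ min (l N) f := le_min (hlnn N) hf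
  have h3 := mono (min (l N) f) f hm0 (min_le_right _ _) le_rfl
  rw [sub_self, zero_mul] at h3
  linarith

/-- Log-sum inequality for the pairs (f, 1) and (a, a): merging them can only decrease f log f + a
log 1. -/
lemma add_mul_log_le_klFun {a f : ℝ} (ha : 0 < a) (hf : 0 ≤ f) :
    (f + a) * Real.log ((f + a) / a) - f + 1 ≤
      InformationTheory.klFun f + Real.log ((1 + a) / a) * f + a * Real.log ((1 + a) / a) := by
  have hfa : 0 < f + a := by linarith
  have h1a : 0 < 1 + a := by linarith
  have key : (f + a) * Real.log ((f + a) / (1 + a)) ≤ f * Real.log f := by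
    have hr : 0 < (f + a) / (1 + a) := by positivity
    have h1 := Real.log_le_sub_one_of_pos hr
    rcases hf.eq_or_lt with rfl | hf
    · have : a * Real.log ((0 + a) / (1 + a)) ≤ 0 :=
        mul_nonpos_of_nonneg_of_nonpos ha.le
          (Real.log_nonpos hr.le ((div_le_one h1a).2 (by linarith)))
      simpa using this
    · have h2 := Real.log_le_sub_one_of_pos (div_pos hr hf)
      rw [Real.log_div hr.ne' hf.ne'] at h2
      have h3 := mul_le_mul_of_nonneg_left h1 ha.le
      have h4 := mul_le_mul_of_nonneg_left h2 hf.le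
      have e : f * ((f + a) / (1 + a) / f - 1) + a * ((f + a) / (1 + a) - 1) = 0 := by
        field_simp; ring
      linarith
  rw [Real.log_div hfa.ne' h1a.ne'] at key
  rw [Real.log_div hfa.ne' ha.ne', Real.log_div h1a.ne' ha.ne', InformationTheory.klFun]
  linarith

/-- All constants of the sampler at a = 2/3, a value that nearly minimises them; the slack is about
0.01. -/
lemma log_constants_le :
    Real.log (3 / 2) + (2 / 3) / (3 / 2) + (1 + 2 / 3) * Real.log ((1 + 2 / 3) / (2 / 3)) - 1 ≤
      2 * Real.log 2 := by
  have h1 : Real.log (84375 / 16384) ≤ 5 / 3 := by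
    have e := Real.exp_one_gt_d9
    have h : 3 * Real.log (84375 / 16384) ≤ 5 := by
      have : 3 * Real.log (84375 / 16384) = Real.log ((84375 / 16384) ^ 3) := by
        rw [Real.log_pow]; norm_num
      rw [this, Real.log_le_iff_le_exp (by norm_num)]
      have h2 : Real.exp 5 = Real.exp 1 ^ 5 := by rw [← Real.exp_nat_mul]; norm_num
      rw [h2]
      calc ((84375 : ℝ) / 16384) ^ 3 ≤ 2.7 ^ 5 := by norm_num
        _ ≤ Real.exp 1 ^ 5 := by gcongr; linarith
    linarith
  have e1 : Real.log (84375 / 16384) = 3 * Real.log 3 + 5 * Real.log 5 - 14 * Real.log 2 := by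
    rw [show (84375 : ℝ) / 16384 = 3 ^ 3 * 5 ^ 5 / 2 ^ 14 by norm_num,
      Real.log_div (by norm_num) (by norm_num), Real.log_mul (by norm_num) (by norm_num),
      Real.log_pow, Real.log_pow, Real.log_pow]
    norm_num
  rw [show ((1 : ℝ) + 2 / 3) / (2 / 3) = 5 / 2 by norm_num, Real.log_div (by norm_num) (by norm_num),
    Real.log_div (by norm_num) (by norm_num)]
  linarith

/-! ### Prefix codes -/

/-- The `ℓ` lowest binary digits of `n`, the most significant first. -/
def natBits (n ℓ : ℕ) : List Bool :=
  List.ofFn fun i : Fin ℓ => n.testBit (ℓ - 1 - i)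

lemma div_two_pow_eq_of_natBits_isPrefix {n m ℓ ℓ' : ℕ} (hℓ : ℓ ≤ ℓ') (hn : n < 2 ^ ℓ)
    (hm : m < 2 ^ ℓ') (h : natBits n ℓ <+: natBits m ℓ') : m / 2 ^ (ℓ' - ℓ) = n := by
  refine Nat.eq_of_testBit_eq fun b => ?_
  rw [Nat.testBit_div_two_pow]
  rcases lt_or_ge b ℓ with hb | hb
  · have h1 := List.prefix_iff_getElem?.1 h (ℓ - 1 - b) (by simp [natBits]; omega)
    simp only [natBits, List.getElem_ofFn, List.getElem?_ofFn] at h1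
    rw [dif_pos (by omega)] at h1
    have h2 := Option.some.inj h1
    rw [show ℓ - 1 - (ℓ - 1 - b) = b by omega,
      show ℓ' - 1 - (ℓ - 1 - b) = b + (ℓ' - ℓ) by omega] at h2
    exact h2
  · rw [Nat.testBit_lt_two_pow (hn.trans_le (Nat.pow_le_pow_right (by norm_num) hb)),
      Nat.testBit_lt_two_pow (hm.trans_le (Nat.pow_le_pow_right (by norm_num) (by omega)))]

/-- The integers that index the canonical prefix code with codeword lengths `ℓ`. -/
def kraftIndex (ℓ : ℕ → ℕ) : ℕ → ℕ
  | 0 => 0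
  | k + 1 => (kraftIndex ℓ k + 1) * 2 ^ (ℓ (k + 1) - ℓ k)

/-- At depth `ℓ k`, the subtree below codeword `j` ends before index `k`; this is what excludes
prefixes. -/
lemma kraftIndex_succ_le {ℓ : ℕ → ℕ} (hℓ : Monotone ℓ) {j k : ℕ} (hjk : j < k) :
    (kraftIndex ℓ j + 1) * 2 ^ (ℓ k - ℓ j) ≤ kraftIndex ℓ k := by
  induction k, hjk using Nat.le_induction with
  | base => rfl
  | succ k hk ih =>
    have h1 : ℓ j ≤ ℓ k := hℓ (Nat.le_of_succ_le hk)
    have h2 : ℓ k ≤ ℓ (k + 1) := hℓ (Nat.le_succ k)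
    calc (kraftIndex ℓ j + 1) * 2 ^ (ℓ (k + 1) - ℓ j)
        = (kraftIndex ℓ j + 1) * 2 ^ (ℓ k - ℓ j) * 2 ^ (ℓ (k + 1) - ℓ k) := by
          rw [mul_assoc, ← pow_add]; congr 2; omega
      _ ≤ (kraftIndex ℓ k + 1) * 2 ^ (ℓ (k + 1) - ℓ k) := by gcongr; omega

lemma kraftIndex_add_one {ℓ : ℕ → ℕ} (hℓ : Monotone ℓ) (k : ℕ) :
    (kraftIndex ℓ k + 1 : ℝ) = (∑ j ∈ Finset.range (k + 1), (1 / 2 : ℝ) ^ ℓ j) * 2 ^ ℓ k := by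
  induction k with
  | zero => simp [kraftIndex]
  | succ k ih =>
    have h2 : ℓ k ≤ ℓ (k + 1) := hℓ (Nat.le_succ k)
    rw [Finset.sum_range_succ, add_mul, kraftIndex]
    push_cast
    rw [ih, mul_assoc, ← pow_add, Nat.add_sub_cancel' h2, ← mul_pow]
    norm_num

/-- Kraft's converse for nondecreasing lengths: there is a prefix code with these lengths. -/
lemma exists_prefix_code {ℓ : ℕ → ℕ} (hℓ : Monotone ℓ)
    (hkraft : ∀ N, ∑ k ∈ Finset.range N, (1 / 2 : ℝ) ^ ℓ k ≤ 1) :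
    ∃ c : ℕ → List Bool, (∀ k, (c k).length = ℓ k) ∧ ∀ j k, c j <+: c k → j = k := by
  have hlt : ∀ k, kraftIndex ℓ k < 2 ^ ℓ k := by
    intro k
    have h : (kraftIndex ℓ k + 1 : ℝ) ≤ 2 ^ ℓ k := by
      rw [kraftIndex_add_one hℓ]
      exact mul_le_of_le_one_left (by positivity) (hkraft _)
    exact_mod_cast h
  have key : ∀ j k, j < k → ¬ natBits (kraftIndex ℓ j) (ℓ j) <+: natBits (kraftIndex ℓ k) (ℓ k) := by
    intro j k hjk h
    have h1 := div_two_pow_eq_of_natBits_isPrefix (hℓ hjk.le) (hlt j) (hlt k) h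
    have h2 := kraftIndex_succ_le hℓ hjk
    rw [← Nat.le_div_iff_mul_le (by positivity), h1] at h2
    omega
  refine ⟨fun k => natBits (kraftIndex ℓ k) (ℓ k), fun k => by simp [natBits], fun j k h => ?_⟩
  rcases lt_trichotomy j k with hjk | hjk | hjk
  · exact absurd h (key j k hjk)
  · exact hjk
  · have hlen := h.length_le
    simp only [natBits, List.length_ofFn] at hlen
    have heq := h.eq_of_length (by simp [natBits, le_antisymm hlen (hℓ hjk.le)])
    exact absurd ⟨[], by rw [List.append_nil]; exact heq.symm⟩ (key k j hjk)

/-- Midpoint rule for the convex function s t^(-1-s) on [k+1, k+2]. The right side factors as a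
geometric-mean term times 2 sinh; AM-GM bounds the first factor, and log(1+x) ≥ 2x/(x+2) with sinh x
≥ x the second. -/
lemma mul_rpow_le_rpow_sub_rpow {s : ℝ} (hs : 0 < s) (k : ℕ) :
    s * (k + 3 / 2 : ℝ) ^ (-1 - s) ≤ (k + 1 : ℝ) ^ (-s) - (k + 2 : ℝ) ^ (-s) := by
  have hk : (0 : ℝ) ≤ k := Nat.cast_nonneg k
  have h1 : (0 : ℝ) < k + 1 := by positivity
  have h2 : (0 : ℝ) < k + 2 := by positivity
  have ht : (0 : ℝ) < k + 3 / 2 := by positivity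
  set A := Real.log (k + 1)
  set B := Real.log (k + 2)
  set T := Real.log (k + 3 / 2)
  have hAB : A + B ≤ 2 * T := by
    have : Real.log ((k + 1) * (k + 2)) ≤ Real.log ((k + 3 / 2 : ℝ) ^ 2) :=
      Real.log_le_log (by positivity) (by nlinarith)
    rw [Real.log_mul h1.ne' h2.ne', Real.log_pow] at this
    simpa only [Nat.cast_ofNat] using this
  have hBA : (k + 3 / 2 : ℝ)⁻¹ ≤ B - A := by
    have h := Real.le_log_one_add_of_nonneg (x := 1 / (k + 1 : ℝ)) (by positivity)
    rw [← Real.log_div h2.ne' h1.ne']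
    calc (k + 3 / 2 : ℝ)⁻¹ = 2 * (1 / (k + 1 : ℝ)) / (1 / (k + 1 : ℝ) + 2) := by field_simp; ring
      _ ≤ _ := h
      _ = _ := by congr 1; field_simp; ring
  have hsinh : s * (B - A) ≤ 2 * Real.sinh (s * (B - A) / 2) := by
    have h0 : 0 ≤ s * (B - A) / 2 := by
      have : 0 ≤ B - A := le_trans (by positivity) hBA
      positivity
    linarith [Real.self_le_sinh_iff.2 h0]
  rw [Real.rpow_def_of_pos h1, Real.rpow_def_of_pos h2, Real.rpow_sub ht, Real.rpow_neg_one,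
    Real.rpow_def_of_pos ht]
  change s * ((k + 3 / 2 : ℝ)⁻¹ / Real.exp (T * s)) ≤ Real.exp (A * -s) - Real.exp (B * -s)
  have e : Real.exp (A * -s) - Real.exp (B * -s)
      = Real.exp (-(s * (A + B) / 2)) * (2 * Real.sinh (s * (B - A) / 2)) := by
    rw [Real.sinh_eq, mul_div_cancel₀ _ (by norm_num : (2 : ℝ) ≠ 0), mul_sub, ← Real.exp_add,
      ← Real.exp_add]
    congr 2 <;> ring
  rw [e]
  calc s * ((k + 3 / 2 : ℝ)⁻¹ / Real.exp (T * s))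
      = Real.exp (-(T * s)) * (s * (k + 3 / 2 : ℝ)⁻¹) := by rw [Real.exp_neg]; field_simp
    _ ≤ Real.exp (-(s * (A + B) / 2)) * (2 * Real.sinh (s * (B - A) / 2)) := by
      refine mul_le_mul (Real.exp_le_exp.2 (by nlinarith)) ?_ (by positivity) (Real.exp_pos _).le
      exact (mul_le_mul_of_nonneg_left hBA hs.le).trans hsinh

lemma sum_mul_rpow_le_one {s : ℝ} (hs : 0 < s) (N : ℕ) :
    ∑ k ∈ Finset.range N, s * (k + 3 / 2 : ℝ) ^ (-1 - s) ≤ 1 := by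
  calc ∑ k ∈ Finset.range N, s * (k + 3 / 2 : ℝ) ^ (-1 - s)
      ≤ ∑ k ∈ Finset.range N, (((k : ℕ) + 1 : ℝ) ^ (-s) - ((k + 1 : ℕ) + 1 : ℝ) ^ (-s)) := by
        refine Finset.sum_le_sum fun k _ => (mul_rpow_le_rpow_sub_rpow hs k).trans_eq ?_
        push_cast
        rw [add_assoc]
        norm_num
    _ = 1 - (N + 1 : ℝ) ^ (-s) := by
        rw [Finset.sum_range_sub' (fun k : ℕ => ((k : ℝ) + 1) ^ (-s))]
        simp
    _ ≤ 1 := by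
        have : 0 ≤ (N + 1 : ℝ) ^ (-s) := by positivity
        linarith

/-- A prefix code for the positive integers that is good for power laws with exponent `1 + s`. -/
lemma exists_prefix_code_length_le {s : ℝ} (hs : 0 < s) :
    ∃ c : ℕ → List Bool, (∀ j k, c j <+: c k → j = k) ∧
      ∀ k, ((c k).length : ℝ) ≤ 1 - Real.logb 2 s + (1 + s) * Real.logb 2 (k + 3 / 2) := by
  set q : ℕ → ℝ := fun k => s * (k + 3 / 2 : ℝ) ^ (-1 - s)
  have hq : ∀ k, 0 < q k := fun k => by positivity
  have hq1 : ∀ k, q k ≤ 1 := fun k =>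
    (Finset.single_le_sum (f := q) (fun j _ => (hq j).le) (Finset.self_mem_range_succ k)).trans
      (sum_mul_rpow_le_one hs (k + 1))
  have hqanti : Antitone q := by
    intro j k hjk
    refine mul_le_mul_of_nonneg_left ?_ hs.le
    have hjk' : (j : ℝ) ≤ k := by exact_mod_cast hjk
    exact Real.rpow_le_rpow_of_nonpos (by positivity) (by linarith) (by linarith)
  -- Shannon lengths for the subprobability `q`; they are nondecreasing because `q` is antitone.
  obtain ⟨c, hc, hpre⟩ := exists_prefix_code (ℓ := fun k => ⌈-Real.logb 2 (q k)⌉₊)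
    (fun j k hjk => Nat.ceil_mono (neg_le_neg
      ((Real.logb_le_logb (by norm_num) (hq k) (hq j)).2 (hqanti hjk)))) (fun N => by
      refine le_trans (Finset.sum_le_sum fun k _ => ?_) (sum_mul_rpow_le_one hs N)
      have h := Nat.le_ceil (-Real.logb 2 (q k))
      rw [one_div, inv_pow]
      refine inv_le_of_inv_le₀ (hq k) ?_
      rw [← Real.rpow_natCast, ← Real.logb_le_iff_le_rpow (by norm_num) (inv_pos.2 (hq k)),
        Real.logb_inv]
      exact h)
  refine ⟨c, hpre, fun k => ?_⟩
  rw [hc]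
  have h0 : 0 ≤ -Real.logb 2 (q k) :=
    neg_nonneg.2 (Real.logb_nonpos (by norm_num) (hq k).le (hq1 k))
  have h1 := (Nat.ceil_lt_add_one h0).le
  have h2 : Real.logb 2 (q k) = Real.logb 2 s + (-1 - s) * Real.logb 2 (k + 3 / 2) := by
    have ht : (0 : ℝ) < k + 3 / 2 := by positivity
    rw [Real.logb_mul hs.ne' (by positivity), Real.logb_rpow_eq_mul_logb_of_pos ht]
  linarith

/-! ### The rejection sampler: levels, survival and accepted densities -/

namespace GreedySampler

variable {𝓨 : Type*} [MeasurableSpace 𝓨]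

/-- The mass of the density `f` above the level `t`. -/
noncomputable def resid (ν : Measure 𝓨) (f : 𝓨 → ℝ≥0∞) (t : ℝ≥0∞) : ℝ≥0∞ :=
  ∫⁻ y, (f y - t) ∂ν

/-- The solution `t` of `t = c + resid ν f t`, written as a countable infimum. -/
noncomputable def nextLevel (ν : Measure 𝓨) (f : 𝓨 → ℝ≥0∞) (c : ℝ≥0∞) : ℝ≥0∞ :=
  ⨅ q : ℚ, if c + resid ν f (ENNReal.ofReal q) ≤ ENNReal.ofReal q then ENNReal.ofReal q else ∞

/-- The level up to which the density `f` is exhausted by the first `k` rounds. -/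
noncomputable def level (ν : Measure 𝓨) (f : 𝓨 → ℝ≥0∞) : ℕ → ℝ≥0∞
  | 0 => 0
  | k + 1 => nextLevel ν f (level ν f k)

/-- The probability that the first `k` rounds reject. -/
noncomputable def surv (ν : Measure 𝓨) (f : 𝓨 → ℝ≥0∞) (k : ℕ) : ℝ≥0∞ :=
  resid ν f (level ν f k)

/-- The density of the samples accepted in round `k`. -/
noncomputable def acc (ν : Measure 𝓨) (f : 𝓨 → ℝ≥0∞) (k : ℕ) (y : 𝓨) : ℝ≥0∞ :=
  min (f y - level ν f k) (surv ν f (k + 1))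

section Measurability

variable {𝓧 : Type*} [MeasurableSpace 𝓧] {ν : Measure 𝓨} [SFinite ν] {F : 𝓧 × 𝓨 → ℝ≥0∞}

lemma measurable_resid (hF : Measurable F) {t : 𝓧 → ℝ≥0∞} (ht : Measurable t) :
    Measurable fun x => resid ν (fun y => F (x, y)) (t x) :=
  Measurable.lintegral_prod_right' (f := fun p : 𝓧 × 𝓨 => F p - t p.1)
    (hF.sub (ht.comp measurable_fst))

/-- Only rational candidates enter `nextLevel`, so measurability in x passes through a countable
infimum. -/
lemma measurable_level (hF : Measurable F) (k : ℕ) :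
    Measurable fun x => level ν (fun y => F (x, y)) k := by
  induction k with
  | zero => exact measurable_const
  | succ k ih =>
    refine Measurable.iInf fun q => Measurable.ite ?_ measurable_const measurable_const
    exact measurableSet_le (ih.add (measurable_resid hF measurable_const)) measurable_const

lemma measurable_surv (hF : Measurable F) (k : ℕ) :
    Measurable fun x => surv ν (fun y => F (x, y)) k :=
  measurable_resid hF (measurable_level hF k)

lemma measurable_acc (hF : Measurable F) (k : ℕ) :
    Measurable fun p : 𝓧 × 𝓨 => acc ν (fun y => F (p.1, y)) k p.2 :=
  (hF.sub ((measurable_level hF k).comp measurable_fst)).min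
    ((measurable_surv hF (k + 1)).comp measurable_fst)

end Measurability

variable {ν : Measure 𝓨} {f : 𝓨 → ℝ≥0∞}

lemma resid_anti : Antitone (resid ν f) := fun _ _ h =>
  lintegral_mono fun _ => tsub_le_tsub_left h _

lemma resid_zero : resid ν f 0 = ∫⁻ y, f y ∂ν := by simp [resid]

lemma measurable_acc_right (hf : Measurable f) (k : ℕ) : Measurable (acc ν f k) :=
  (hf.sub measurable_const).min measurable_const

lemma surv_zero (hf1 : ∫⁻ y, f y ∂ν = 1) : surv ν f 0 = 1 := resid_zero.trans hf1

lemma resid_le_one (hf1 : ∫⁻ y, f y ∂ν = 1) (t : ℝ≥0∞) : resid ν f t ≤ 1 :=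
  (resid_anti zero_le).trans_eq (resid_zero.trans hf1)

lemma nextLevel_ne_top (hf1 : ∫⁻ y, f y ∂ν = 1) {c : ℝ≥0∞} (hc : c ≠ ∞) : nextLevel ν f c ≠ ∞ := by
  have h : c + 1 < ∞ := ENNReal.add_lt_top.2 ⟨hc.lt_top, ENNReal.one_lt_top⟩
  obtain ⟨q, -, hq, -⟩ := ENNReal.lt_iff_exists_rat_btwn.1 h
  refine ((iInf_le _ q).trans_lt ?_).ne
  rw [if_pos]
  · exact ENNReal.ofReal_lt_top
  · exact (add_le_add_right (resid_le_one hf1 _) c).trans hq.le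

lemma surv_le_one (hf1 : ∫⁻ y, f y ∂ν = 1) (k : ℕ) : surv ν f k ≤ 1 := resid_le_one hf1 _

lemma level_ne_top (hf1 : ∫⁻ y, f y ∂ν = 1) (k : ℕ) : level ν f k ≠ ∞ := by
  induction k with
  | zero => exact ENNReal.zero_ne_top
  | succ k ih => exact nextLevel_ne_top hf1 ih

lemma surv_ne_top (hf1 : ∫⁻ y, f y ∂ν = 1) (k : ℕ) : surv ν f k ≠ ∞ :=
  ((surv_le_one hf1 k).trans_lt ENNReal.one_lt_top).ne

variable [IsProbabilityMeasure ν]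

/-- The residual is 1-Lipschitz in the level, because ν has mass 1. -/
lemma resid_le_add (t t' : ℝ≥0∞) : resid ν f t ≤ resid ν f t' + (t' - t) := by
  calc resid ν f t ≤ ∫⁻ y, ((f y - t') + (t' - t)) ∂ν :=
        lintegral_mono fun _ => tsub_le_tsub_add_tsub
    _ = resid ν f t' + (t' - t) := by
        rw [lintegral_add_right _ measurable_const, lintegral_const, measure_univ, mul_one, resid]

variable (hf1 : ∫⁻ y, f y ∂ν = 1)
include hf1

lemma nextLevel_eq {c : ℝ≥0∞} (hc : c ≠ ∞) :
    nextLevel ν f c = c + resid ν f (nextLevel ν f c) := by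
  have hT := nextLevel_ne_top hf1 hc
  set T := nextLevel ν f c with hTdef
  apply le_antisymm
  · by_contra! hlt
    set d := c + resid ν f T
    -- Lowering T to q raises the residual by at most T - q, so any q above the midpoint of d and T
    -- is still admissible, against minimality.
    have hdT : (d + T) / 2 < T := by
      rw [ENNReal.div_lt_iff (by simp) (by simp), mul_two]
      exact ENNReal.add_lt_add_right hT hlt
    obtain ⟨q, -, hq1, hq2⟩ := ENNReal.lt_iff_exists_rat_btwn.1 hdT
    change (d + T) / 2 < ENNReal.ofReal q at hq1
    change ENNReal.ofReal q < T at hq2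
    refine absurd hq2 (not_lt.2 ?_)
    refine (iInf_le _ q).trans_eq (if_pos ?_)
    have h1 : c + resid ν f (ENNReal.ofReal q) ≤ d + (T - ENNReal.ofReal q) := by
      rw [add_assoc]
      exact add_le_add_right (resid_le_add _ _) c
    refine h1.trans ?_
    rw [← ENNReal.add_le_add_iff_right (ENNReal.ofReal_ne_top (r := q)), add_assoc,
      tsub_add_cancel_of_le hq2.le, ← mul_two]
    exact (ENNReal.div_le_iff (by simp) (by simp)).1 hq1.le
  · refine ENNReal.le_of_forall_pos_le_add fun ε hε _ => ?_
    have hlt : T < T + ε / 2 := ENNReal.lt_add_right hT (by simp [hε.ne'])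
    obtain ⟨q, hq⟩ := iInf_lt_iff.1 (hTdef ▸ hlt)
    split_ifs at hq with hcq
    · have hTq : T ≤ ENNReal.ofReal q := (iInf_le _ q).trans_eq (if_pos hcq)
      calc c + resid ν f T ≤ c + (resid ν f (ENNReal.ofReal q) + (ENNReal.ofReal q - T)) :=
            add_le_add_right (resid_le_add _ _) c
        _ = c + resid ν f (ENNReal.ofReal q) + (ENNReal.ofReal q - T) := (add_assoc _ _ _).symm
        _ ≤ (T + ε / 2) + (ε / 2) := by
            refine add_le_add (hcq.trans hq.le) ?_
            rw [tsub_le_iff_left]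
            exact hq.le
        _ = T + ε := by rw [add_assoc, ENNReal.add_halves]
    · exact absurd hq not_top_lt

lemma level_succ (k : ℕ) : level ν f (k + 1) = level ν f k + surv ν f (k + 1) :=
  nextLevel_eq hf1 (level_ne_top hf1 k)

lemma level_mono : Monotone (level ν f) :=
  monotone_nat_of_le_succ fun k => (level_succ hf1 k) ▸ le_self_add

lemma surv_anti : Antitone (surv ν f) := fun _ _ h => resid_anti (level_mono hf1 h)

/-- By the implicit equation, the cap `surv ν f (k + 1)` is exactly the increment of the level, so
the accepted densities are successive horizontal slices of f. -/
lemma acc_add (k : ℕ) (y : 𝓨) : acc ν f k y + (f y - level ν f (k + 1)) = f y - level ν f k := by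
  rw [level_succ hf1, ← tsub_tsub, add_comm, acc, tsub_add_min]

lemma lintegral_acc_add (hf : Measurable f) (k : ℕ) :
    ∫⁻ y, acc ν f k y ∂ν + surv ν f (k + 1) = surv ν f k := by
  rw [surv, resid, ← lintegral_add_left (measurable_acc_right hf k)]
  simp_rw [acc_add hf1]
  rfl

lemma sum_acc_add (N : ℕ) (y : 𝓨) :
    ∑ k ∈ Finset.range N, acc ν f k y + (f y - level ν f N) = f y := by
  induction N with
  | zero => simp [level]
  | succ N ih => rw [Finset.sum_range_succ, add_assoc, acc_add hf1, ih]

lemma sum_lintegral_acc_add (hf : Measurable f) (N : ℕ) :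
    ∑ k ∈ Finset.range N, ∫⁻ y, acc ν f k y ∂ν + surv ν f N = 1 := by
  induction N with
  | zero => simp [surv_zero hf1]
  | succ N ih => rw [Finset.sum_range_succ, add_assoc, lintegral_acc_add hf1 hf, ih]

lemma tsum_acc_le (y : 𝓨) : ∑' k, acc ν f k y ≤ f y := by
  rw [ENNReal.tsum_eq_iSup_nat]
  exact iSup_le fun N => le_self_add.trans_eq (sum_acc_add hf1 N y)

lemma nat_mul_surv_le (N : ℕ) : N * surv ν f N ≤ level ν f N := by
  induction N with
  | zero => simp
  | succ N ih =>
    rw [level_succ hf1, Nat.cast_succ, add_mul, one_mul]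
    gcongr
    exact (mul_le_mul_right (surv_anti hf1 (Nat.le_succ N)) _).trans ih

/-- If the survival stayed above s > 0, the levels would exceed N s and tend to infinity, so the
mass of f above them would vanish by dominated convergence. -/
lemma tendsto_surv (hf : Measurable f) : Filter.Tendsto (surv ν f) Filter.atTop (nhds 0) := by
  have hanti := tendsto_atTop_iInf (surv_anti (ν := ν) hf1)
  set s := ⨅ k, surv ν f k
  suffices hs : s = 0 by rwa [hs] at hanti
  by_contra hs
  have h1 : ∀ N : ℕ, surv ν f N ≤ ∫⁻ y, (f y - N * s) ∂ν := fun N =>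
    resid_anti ((mul_le_mul_right (iInf_le _ N) _).trans (nat_mul_surv_le hf1 N))
  have h2 : Filter.Tendsto (fun N : ℕ => ∫⁻ y, (f y - N * s) ∂ν) Filter.atTop
      (nhds (∫⁻ _, 0 ∂ν)) := by
    refine tendsto_lintegral_of_dominated_convergence f
      (fun N => hf.sub measurable_const) (fun N => .of_forall fun y => tsub_le_self)
      (by rw [hf1]; exact ENNReal.one_ne_top) ?_
    filter_upwards [ae_lt_top hf (by rw [hf1]; exact ENNReal.one_ne_top)] with y hy
    obtain ⟨n, hn⟩ := ENNReal.exists_nat_mul_gt hs hy.ne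
    refine tendsto_const_nhds.congr' ?_
    filter_upwards [Filter.eventually_ge_atTop n] with N hN
    refine (tsub_eq_zero_of_le (hn.le.trans ?_)).symm
    gcongr
  rw [lintegral_zero] at h2
  exact hs (tendsto_nhds_unique hanti
    (tendsto_of_tendsto_of_tendsto_of_le_of_le tendsto_const_nhds h2 (fun _ => zero_le) h1))

lemma tsum_lintegral_acc (hf : Measurable f) : ∑' k, ∫⁻ y, acc ν f k y ∂ν = 1 := by
  have h1 := ENNReal.tendsto_nat_tsum fun k => ∫⁻ y, acc ν f k y ∂ν
  have h2 : Filter.Tendsto (fun N => 1 - surv ν f N) Filter.atTop (nhds (1 - 0)) :=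
    ENNReal.Tendsto.sub tendsto_const_nhds (tendsto_surv hf1 hf) (.inl ENNReal.one_ne_top)
  rw [tsub_zero] at h2
  refine tendsto_nhds_unique h1 (h2.congr fun N => ?_)
  rw [← sum_lintegral_acc_add hf1 hf N]
  exact ENNReal.add_sub_cancel_right (surv_ne_top hf1 N)

/-- The slices sum to at most f pointwise and have total mass 1 = ∫ f, hence they sum to f almost
everywhere. -/
lemma tsum_setLIntegral_acc (hf : Measurable f) (B : Set 𝓨) :
    ∑' k, ∫⁻ y in B, acc ν f k y ∂ν = ∫⁻ y in B, f y ∂ν := by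
  rw [← lintegral_tsum fun k => (measurable_acc_right hf k).aemeasurable]
  refine lintegral_congr_ae (ae_restrict_of_ae ?_)
  refine ae_eq_of_ae_le_of_lintegral_le (.of_forall (tsum_acc_le hf1)) ?_ hf.aemeasurable ?_
  · rw [lintegral_tsum fun k => (measurable_acc_right hf k).aemeasurable,
      tsum_lintegral_acc hf1 hf]
    exact ENNReal.one_ne_top
  · rw [lintegral_tsum fun k => (measurable_acc_right hf k).aemeasurable,
      tsum_lintegral_acc hf1 hf, hf1]

end GreedySampler

/-! ### The mean logarithm of the number of rounds -/

namespace GreedySampler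

variable {𝓨 : Type*} [MeasurableSpace 𝓨] {ν : Measure 𝓨} [IsProbabilityMeasure ν] {f : 𝓨 → ℝ≥0∞}

/-- Each survival probability is written as an integral over y, and the pointwise Riemann-sum and
log-sum bounds are integrated. The summand 1 on the left comes from klFun f = f log f + 1 - f; its
place there avoids a truncated subtraction. -/
lemma sum_surv_mul_log_le (hf1 : ∫⁻ y, f y ∂ν = 1) (hf : Measurable f) {a : ℝ} (ha : 0 < a)
    (N : ℕ) :
    ∑ k ∈ Finset.range N, surv ν f (k + 1) * ENNReal.ofReal (Real.log
      (((level ν f (k + 1)).toReal + a) / ((level ν f k).toReal + a))) + 1 ≤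
    ∫⁻ y, ENNReal.ofReal (InformationTheory.klFun (f y).toReal) ∂ν
      + ENNReal.ofReal (Real.log ((1 + a) / a)) + ENNReal.ofReal (a * Real.log ((1 + a) / a)) := by
  set l : ℕ → ℝ := fun k => (level ν f k).toReal with hl
  have hlmono : Monotone l := fun j k hjk =>
    ENNReal.toReal_mono (level_ne_top hf1 k) (level_mono hf1 hjk)
  have hl0 : l 0 = 0 := by simp [hl, level]
  have hlnn : ∀ k, 0 ≤ l k := fun k => ENNReal.toReal_nonneg
  set R : ℕ → ℝ := fun k => Real.log ((l (k + 1) + a) / (l k + a)) with hR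
  have hRnn : ∀ k, 0 ≤ R k := fun k => Real.log_nonneg
    ((one_le_div (by linarith [hlnn k])).2 (by linarith [hlmono (Nat.le_succ k)]))
  set C := Real.log ((1 + a) / a)
  have hC : 0 ≤ C := Real.log_nonneg ((one_le_div ha).2 (by linarith))
  have hmeas : Measurable fun y => ENNReal.ofReal (InformationTheory.klFun (f y).toReal) :=
    (InformationTheory.measurable_klFun.comp hf.ennreal_toReal).ennreal_ofReal
  have hsub : ∀ k, Measurable fun y => f y - level ν f (k + 1) := fun k => hf.sub measurable_const
  have e1 : ∑ k ∈ Finset.range N, surv ν f (k + 1) * ENNReal.ofReal (R k) + 1 =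
      ∫⁻ y, (∑ k ∈ Finset.range N, (f y - level ν f (k + 1)) * ENNReal.ofReal (R k) + 1) ∂ν := by
    rw [lintegral_add_right _ measurable_const, lintegral_finsetSum _ fun k _ =>
      (hsub k).mul_const _]
    simp only [lintegral_const, measure_univ, mul_one]
    congr 1
    refine Finset.sum_congr rfl fun k _ => ?_
    rw [lintegral_mul_const _ (hsub k)]
    rfl
  have e2 : ∫⁻ y, ENNReal.ofReal (InformationTheory.klFun (f y).toReal) ∂ν
      + ENNReal.ofReal C + ENNReal.ofReal (a * C) =
      ∫⁻ y, (ENNReal.ofReal (InformationTheory.klFun (f y).toReal) + ENNReal.ofReal C * f y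
        + ENNReal.ofReal (a * C)) ∂ν := by
    rw [lintegral_add_right _ measurable_const, lintegral_add_left hmeas,
      lintegral_const_mul _ hf, hf1]
    simp
  rw [e1, e2]
  refine lintegral_mono_ae ?_
  filter_upwards [ae_lt_top hf (by rw [hf1]; exact ENNReal.one_ne_top)] with y hy
  obtain ⟨r, hr, hfr⟩ : ∃ r : ℝ, 0 ≤ r ∧ f y = ENNReal.ofReal r :=
    ⟨(f y).toReal, ENNReal.toReal_nonneg, (ENNReal.ofReal_toReal hy.ne).symm⟩
  rw [hfr, ENNReal.toReal_ofReal hr]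
  have h1 : ∀ k, (ENNReal.ofReal r - level ν f (k + 1)) * ENNReal.ofReal (R k)
      = ENNReal.ofReal (max (r - l (k + 1)) 0 * R k) := by
    intro k
    rw [ENNReal.ofReal_mul (le_max_right _ _), ENNReal.ofReal_max, ENNReal.ofReal_zero,
      max_eq_left zero_le, ENNReal.ofReal_sub _ (hlnn _), hl,
      ENNReal.ofReal_toReal (level_ne_top hf1 _)]
  simp_rw [h1]
  have hkl := InformationTheory.klFun_nonneg hr
  rw [← ENNReal.ofReal_sum_of_nonneg fun k _ => mul_nonneg (le_max_right _ _) (hRnn k),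
    ← ENNReal.ofReal_one, ← ENNReal.ofReal_add (Finset.sum_nonneg fun k _ =>
      mul_nonneg (le_max_right _ _) (hRnn k)) zero_le_one, ← ENNReal.ofReal_mul hC,
    ← ENNReal.ofReal_add hkl (mul_nonneg hC hr),
    ← ENNReal.ofReal_add (add_nonneg hkl (mul_nonneg hC hr)) (mul_nonneg ha.le hC)]
  refine ENNReal.ofReal_le_ofReal ?_
  have h2 := sum_max_mul_log_le hl0 hlmono ha hr N
  have h3 := add_mul_log_le_klFun ha hr
  linarith

/-- The logarithm of the number of rounds is, on average, at most the divergence plus two bits. -/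
lemma tsum_acc_mul_log_le (hf1 : ∫⁻ y, f y ∂ν = 1) (hf : Measurable f) :
    ∑' k : ℕ, (∫⁻ y, acc ν f k y ∂ν) * ENNReal.ofReal (Real.log (k + 3 / 2)) ≤
      ∫⁻ y, ENNReal.ofReal (InformationTheory.klFun (f y).toReal) ∂ν
        + ENNReal.ofReal (2 * Real.log 2) := by
  set D := ∫⁻ y, ENNReal.ofReal (InformationTheory.klFun (f y).toReal) ∂ν
  rcases eq_or_ne D ∞ with hD | hD
  · rw [hD, top_add]; exact le_top
  rw [ENNReal.tsum_eq_iSup_nat]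
  refine iSup_le fun N => ?_
  set s : ℕ → ℝ := fun k => (surv ν f k).toReal with hs
  set l : ℕ → ℝ := fun k => (level ν f k).toReal with hl
  have ha : (0 : ℝ) < 2 / 3 := by norm_num
  have hsl : ∀ k, l (k + 1) = l k + s (k + 1) := fun k => by
    simp only [hl, hs]
    rw [level_succ hf1, ENNReal.toReal_add (level_ne_top hf1 k) (surv_ne_top hf1 _)]
  have hsnn : ∀ k, 0 ≤ s k := fun k => ENNReal.toReal_nonneg
  have hlnn : ∀ k, 0 ≤ l k := fun k => ENNReal.toReal_nonneg
  have hacc : ∀ k, ∫⁻ y, acc ν f k y ∂ν = ENNReal.ofReal (s k - s (k + 1)) := by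
    intro k
    rw [ENNReal.ofReal_sub _ (hsnn _), hs, ENNReal.ofReal_toReal (surv_ne_top hf1 _),
      ENNReal.ofReal_toReal (surv_ne_top hf1 _), ← lintegral_acc_add hf1 hf k]
    exact (ENNReal.add_sub_cancel_right (surv_ne_top hf1 _)).symm
  have hsanti : ∀ k, 0 ≤ s k - s (k + 1) := fun k => sub_nonneg.2
    (ENNReal.toReal_mono (surv_ne_top hf1 _) (surv_anti hf1 (Nat.le_succ k)))
  have hlog : ∀ k : ℕ, 0 ≤ Real.log (k + 3 / 2) := fun k =>
    Real.log_nonneg (by linarith [(Nat.cast_nonneg k : (0 : ℝ) ≤ k)])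
  have hR : ∀ k, 0 ≤ Real.log ((l (k + 1) + 2 / 3) / (l k + 2 / 3)) := fun k => Real.log_nonneg
    ((one_le_div (by linarith [hlnn k])).2 (by linarith [hsl k, hsnn (k + 1)]))
  have h1 := sum_sub_mul_log_le (s := s) (l := l) (by simp [hs, surv_zero hf1]) hsnn
    (by simp [hl, level]) hsl ha N
  have h2 := sum_surv_mul_log_le hf1 hf ha N
  change _ ≤ D + _ + _ at h2
  have h3 : ∑ k ∈ Finset.range N, s (k + 1) * Real.log ((l (k + 1) + 2 / 3) / (l k + 2 / 3)) + 1 ≤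
      D.toReal + Real.log ((1 + 2 / 3) / (2 / 3)) + 2 / 3 * Real.log ((1 + 2 / 3) / (2 / 3)) := by
    have hC : 0 ≤ Real.log ((1 + 2 / 3 : ℝ) / (2 / 3)) := Real.log_nonneg (by norm_num)
    have hne : ∀ k ∈ Finset.range N, surv ν f (k + 1) * ENNReal.ofReal (Real.log
        ((l (k + 1) + 2 / 3) / (l k + 2 / 3))) ≠ ∞ := fun k _ =>
      ENNReal.mul_ne_top (surv_ne_top hf1 _) ENNReal.ofReal_ne_top
    have h4 := ENNReal.toReal_mono (by simp [hD]) h2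
    rw [ENNReal.toReal_add (by simp [hD]) ENNReal.ofReal_ne_top, ENNReal.toReal_add hD (by simp),
      ENNReal.toReal_ofReal hC, ENNReal.toReal_ofReal (by positivity),
      ENNReal.toReal_add (ENNReal.sum_ne_top.2 hne) (by simp), ENNReal.toReal_sum hne,
      ENNReal.toReal_one] at h4
    refine le_trans (le_of_eq ?_) h4
    congr 1
    refine Finset.sum_congr rfl fun k _ => ?_
    rw [ENNReal.toReal_mul, ENNReal.toReal_ofReal (hR k)]
  have h5 := log_constants_le
  simp_rw [hacc]
  calc ∑ k ∈ Finset.range N, ENNReal.ofReal (s k - s (k + 1)) * ENNReal.ofReal (Real.log (k + 3 / 2))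
      = ENNReal.ofReal (∑ k ∈ Finset.range N, (s k - s (k + 1)) * Real.log (k + 3 / 2)) := by
        rw [ENNReal.ofReal_sum_of_nonneg fun k _ => mul_nonneg (hsanti k) (hlog k)]
        exact Finset.sum_congr rfl fun k _ => (ENNReal.ofReal_mul (hsanti k)).symm
    _ ≤ ENNReal.ofReal (D.toReal + 2 * Real.log 2) := ENNReal.ofReal_le_ofReal (by linarith)
    _ = D + ENNReal.ofReal (2 * Real.log 2) := by
        rw [ENNReal.ofReal_add ENNReal.toReal_nonneg (by positivity), ENNReal.ofReal_toReal hD]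

end GreedySampler

/-! ### First hitting times of i.i.d. sequences -/

section FirstHit

variable {Z : Type*} [MeasurableSpace Z]

/-- The event that the sequence `w` hits the sets `A` for the first time at time `k`. -/
def firstHitSet (A : ℕ → Set Z) (k : ℕ) : Set (ℕ → Z) :=
  {w | w k ∈ A k ∧ ∀ j < k, w j ∉ A j}

/-- The first time at which `w` hits the sets `A`, and zero if there is none. -/
noncomputable def firstHit (A : ℕ → Set Z) (w : ℕ → Z) : ℕ :=
  sInf {k | w k ∈ A k}

omit [MeasurableSpace Z] in
lemma firstHit_eq {A : ℕ → Set Z} {k : ℕ} {w : ℕ → Z} (hw : w ∈ firstHitSet A k) :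
    firstHit A w = k := by
  refine le_antisymm (Nat.sInf_le hw.1) (le_csInf ⟨k, hw.1⟩ fun j hj => ?_)
  by_contra! hlt
  exact hw.2 j hlt hj

lemma measurableSet_firstHitSet {A : ℕ → Set Z} (hA : ∀ k, MeasurableSet (A k)) (k : ℕ) :
    MeasurableSet (firstHitSet A k) := by
  have h : firstHitSet A k = (fun w => w k) ⁻¹' A k ∩ ⋂ j, ⋂ (_ : j < k), (fun w => w j) ⁻¹' (A j)ᶜ := by
    ext w; simp [firstHitSet]
  rw [h]
  exact (measurable_pi_apply k (hA k)).inter (MeasurableSet.iInter fun j =>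
    MeasurableSet.iInter fun _ => measurable_pi_apply j (hA j).compl)

lemma infinitePi_firstHitSet_inter (π : Measure Z) [IsProbabilityMeasure π] {A : ℕ → Set Z}
    (hA : ∀ k, MeasurableSet (A k)) (k : ℕ) {B : Set Z} (hB : MeasurableSet B) :
    Measure.infinitePi (fun _ : ℕ => π) (firstHitSet A k ∩ {w | w k ∈ B}) =
      (∏ j ∈ Finset.range k, (1 - π (A j))) * π (A k ∩ B) := by
  have h : firstHitSet A k ∩ {w | w k ∈ B} = Set.pi (Finset.range (k + 1) : Set ℕ)
      fun j => if j = k then A k ∩ B else (A j)ᶜ := by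
    ext w
    simp only [firstHitSet, Set.mem_inter_iff, Set.mem_ofPred_eq, Set.mem_pi, Finset.coe_range,
      Set.mem_Iio]
    constructor
    · rintro ⟨⟨h1, h2⟩, h3⟩ j hj
      split_ifs with hjk
      · rw [hjk]; exact ⟨h1, h3⟩
      · exact h2 j (by omega)
    · intro h
      have hk := h k (by omega)
      rw [if_pos rfl] at hk
      refine ⟨⟨hk.1, fun j hj => ?_⟩, hk.2⟩
      have := h j (by omega)
      rwa [if_neg hj.ne] at this
  rw [h, Measure.infinitePi_pi, Finset.prod_range_succ, if_pos rfl]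
  · congr 1
    refine Finset.prod_congr rfl fun j hj => ?_
    rw [if_neg (Finset.mem_range.1 hj).ne, prob_compl_eq_one_sub (hA j)]
  · intro j _
    split_ifs
    · exact (hA k).inter hB
    · exact (hA j).compl

/-- If some set is hit almost surely, an integral of the hitting time and the hitting point splits
over the hitting times. -/
lemma lintegral_firstHit {P : Measure (ℕ → Z)} [IsProbabilityMeasure P] {A : ℕ → Set Z}
    (hA : ∀ k, MeasurableSet (A k)) (hsum : ∑' k, P (firstHitSet A k) = 1)
    (φ : ℕ → (ℕ → Z) → ℝ≥0∞) :
    ∫⁻ w, φ (firstHit A w) w ∂P = ∑' k, ∫⁻ w in firstHitSet A k, φ k w ∂P := by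
  have hdisj : Pairwise (Function.onFun Disjoint (firstHitSet A)) := fun j k hjk =>
    Set.disjoint_left.2 fun w hj hk => hjk ((firstHit_eq hj).symm.trans (firstHit_eq hk))
  have hU : P (⋃ k, firstHitSet A k) = 1 := by
    rw [measure_iUnion hdisj (measurableSet_firstHitSet hA), hsum]
  rw [← setLIntegral_univ, ← setLIntegral_congr (s := ⋃ k, firstHitSet A k)
    (ae_eq_univ.2 ((prob_compl_eq_zero_iff (.iUnion (measurableSet_firstHitSet hA))).2 hU)),
    lintegral_iUnion (measurableSet_firstHitSet hA) hdisj]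
  refine tsum_congr fun k => setLIntegral_congr_fun (measurableSet_firstHitSet hA k) ?_
  intro w hw
  simp only [firstHit_eq hw]

end FirstHit

lemma measurable_firstHit {𝓧 Z : Type*} [MeasurableSpace 𝓧] [MeasurableSpace Z]
    {A : 𝓧 → ℕ → Set Z} (hA : ∀ k, MeasurableSet {p : 𝓧 × Z | p.2 ∈ A p.1 k}) :
    Measurable fun p : 𝓧 × (ℕ → Z) => firstHit (A p.1) p.2 := by
  have hm : ∀ k, MeasurableSet {p : 𝓧 × (ℕ → Z) | p.2 k ∈ A p.1 k} := fun k =>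
    (hA k).preimage (f := fun p : 𝓧 × (ℕ → Z) => (p.1, p.2 k))
      (measurable_fst.prodMk ((measurable_pi_apply k).comp measurable_snd))
  refine measurable_to_countable' fun n => ?_
  have hn : MeasurableSet {p : 𝓧 × (ℕ → Z) | p.2 ∈ firstHitSet (A p.1) n} := by
    have h : {p : 𝓧 × (ℕ → Z) | p.2 ∈ firstHitSet (A p.1) n} =
        {p | p.2 n ∈ A p.1 n} ∩ ⋂ j, ⋂ (_ : j < n), {p | p.2 j ∈ A p.1 j}ᶜ := by
      ext p; simp [firstHitSet]
    rw [h]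
    exact (hm n).inter (MeasurableSet.iInter fun j => MeasurableSet.iInter fun _ => (hm j).compl)
  -- The fibre over 0 also contains the sequences that never hit, as `sInf ∅ = 0`.
  have h0 : MeasurableSet {p : 𝓧 × (ℕ → Z) | (∀ k, p.2 k ∉ A p.1 k) ∧ n = 0} := by
    have h : {p : 𝓧 × (ℕ → Z) | (∀ k, p.2 k ∉ A p.1 k) ∧ n = 0} =
        (⋂ k, {p | p.2 k ∈ A p.1 k}ᶜ) ∩ {_p | n = 0} := by
      ext p; simp
    rw [h]
    exact (MeasurableSet.iInter fun j => (hm j).compl).inter (MeasurableSet.const _)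
  convert hn.union h0
  ext p
  simp only [Set.mem_preimage, Set.mem_singleton_iff, Set.mem_union, Set.mem_ofPred_eq]
  constructor
  · rintro h
    by_cases hne : ∃ k, p.2 k ∈ A p.1 k
    · left
      have h1 : firstHit (A p.1) p.2 ∈ {k | p.2 k ∈ A p.1 k} := Nat.sInf_mem hne
      rw [h] at h1
      exact ⟨h1, fun j hj hjA => absurd (Nat.sInf_le (s := {k | p.2 k ∈ A p.1 k}) hjA)
        (not_le.2 (show j < firstHit (A p.1) p.2 from h.symm ▸ hj))⟩
    · right
      push Not at hne
      refine ⟨hne, ?_⟩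
      rw [← h, firstHit]
      have : {k | p.2 k ∈ A p.1 k} = ∅ := by ext k; simp [hne k]
      rw [this, Nat.sInf_empty]
  · rintro (h | ⟨h, rfl⟩)
    · exact firstHit_eq h
    · have : {k | p.2 k ∈ A p.1 k} = ∅ := by ext k; simp [h k]
      rw [firstHit, this, Nat.sInf_empty]

/-! ### Realising the sampler with i.i.d. proposals -/

namespace GreedySampler

lemma mul_volume_ofReal_mul_lt {c s : ℝ≥0∞} (hcs : c ≤ s) (hs : s ≠ ∞) :
    s * volume.restrict (Set.Icc (0 : ℝ) 1) {u | ENNReal.ofReal u * s < c} = c := by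
  rcases eq_or_ne s 0 with rfl | hs0
  · rw [zero_mul, le_zero_iff.1 hcs]
  have ht1 : c / s ≤ 1 := ENNReal.div_le_of_le_mul (by rwa [one_mul])
  have htop : c / s ≠ ∞ := (ht1.trans_lt ENNReal.one_lt_top).ne
  have ht : (c / s).toReal ≤ 1 := by simpa using ENNReal.toReal_mono ENNReal.one_ne_top ht1
  have hmeas : MeasurableSet {u : ℝ | ENNReal.ofReal u * s < c} :=
    measurableSet_lt (ENNReal.measurable_ofReal.mul_const _) measurable_const
  have hset : {u : ℝ | ENNReal.ofReal u * s < c} ∩ Set.Icc 0 1 = Set.Ico 0 (c / s).toReal := by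
    ext u
    simp only [Set.mem_inter_iff, Set.mem_ofPred_eq, Set.mem_Icc, Set.mem_Ico]
    rw [← ENNReal.lt_div_iff_mul_lt (.inl hs0) (.inl hs)]
    constructor
    · rintro ⟨h1, h2, -⟩
      exact ⟨h2, (ENNReal.ofReal_lt_iff_lt_toReal h2 htop).1 h1⟩
    · rintro ⟨h1, h2⟩
      exact ⟨(ENNReal.ofReal_lt_iff_lt_toReal h1 htop).2 h2, h1, h2.le.trans ht⟩
  rw [Measure.restrict_apply hmeas, hset, Real.volume_Ico, sub_zero, ENNReal.ofReal_toReal htop,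
    ENNReal.mul_div_cancel hs0 hs]

variable {𝓨 : Type*} [MeasurableSpace 𝓨]

/-- The proposals, with an independent uniform variable for each of them. -/
noncomputable def proposal (ρ : Measure ℝ) : Measure (ℝ × ℝ) :=
  ρ.prod (volume.restrict (Set.Icc 0 1))

instance (ρ : Measure ℝ) [IsProbabilityMeasure ρ] : IsProbabilityMeasure (proposal ρ) := by
  have : IsProbabilityMeasure (volume.restrict (Set.Icc (0 : ℝ) 1)) := ⟨by simp⟩
  unfold proposal
  infer_instance

/-- The proposals `z` that are accepted in round `k`; the sample itself is `ψ z.1`. -/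
def acceptSet (ν : Measure 𝓨) (f : 𝓨 → ℝ≥0∞) (ψ : ℝ → 𝓨) (k : ℕ) : Set (ℝ × ℝ) :=
  {z | ENNReal.ofReal z.2 * surv ν f k < acc ν f k (ψ z.1)}

lemma measurableSet_acceptSet_prod {𝓧 : Type*} [MeasurableSpace 𝓧] {ν : Measure 𝓨} [SFinite ν]
    {F : 𝓧 × 𝓨 → ℝ≥0∞} (hF : Measurable F) {ψ : ℝ → 𝓨} (hψ : Measurable ψ) (k : ℕ) :
    MeasurableSet {p : 𝓧 × (ℝ × ℝ) | p.2 ∈ acceptSet ν (fun y => F (p.1, y)) ψ k} := by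
  change MeasurableSet {p : 𝓧 × (ℝ × ℝ) | ENNReal.ofReal p.2.2 * surv ν (fun y => F (p.1, y)) k <
    acc ν (fun y => F (p.1, y)) k (ψ p.2.1)}
  refine measurableSet_lt ?_ ?_
  · exact (ENNReal.measurable_ofReal.comp (measurable_snd.comp measurable_snd)).mul
      ((measurable_surv hF k).comp measurable_fst)
  · exact (measurable_acc hF k).comp
      (measurable_fst.prodMk (hψ.comp (measurable_fst.comp measurable_snd)))

variable {ν : Measure 𝓨} {f : 𝓨 → ℝ≥0∞} {ψ : ℝ → 𝓨} {ρ : Measure ℝ}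

lemma measurableSet_acceptSet (hf : Measurable f) (hψ : Measurable ψ) (k : ℕ) :
    MeasurableSet (acceptSet ν f ψ k) :=
  measurableSet_lt ((ENNReal.measurable_ofReal.comp measurable_snd).mul_const _)
    ((measurable_acc_right hf k).comp (hψ.comp measurable_fst))

variable [IsProbabilityMeasure ν] [IsProbabilityMeasure ρ]
  (hψ : Measurable ψ) (hρ : ρ.map ψ = ν) (hf1 : ∫⁻ y, f y ∂ν = 1) (hf : Measurable f)
include hψ hρ hf1 hf

-- A proposal y is accepted with conditional probability acc/surv. The statement is multiplied out,
-- so that it also holds once the survival probability is 0.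
omit [IsProbabilityMeasure ρ] in
lemma surv_mul_proposal_acceptSet_inter (k : ℕ) {B : Set 𝓨} (hB : MeasurableSet B) :
    surv ν f k * proposal ρ (acceptSet ν f ψ k ∩ {z | ψ z.1 ∈ B}) = ∫⁻ y in B, acc ν f k y ∂ν := by
  have hm : MeasurableSet (acceptSet ν f ψ k ∩ {z | ψ z.1 ∈ B}) :=
    (measurableSet_acceptSet hf hψ k).inter ((hψ.comp measurable_fst) hB)
  rw [proposal, Measure.prod_apply hm, ← lintegral_const_mul _ (measurable_measure_prodMk_left hm),
    ← lintegral_indicator hB]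
  have hmap := lintegral_map (μ := ρ) ((measurable_acc_right (ν := ν) hf k).indicator hB) hψ
  rw [hρ] at hmap
  rw [hmap]
  refine lintegral_congr fun r => ?_
  by_cases hr : ψ r ∈ B
  · rw [Set.indicator_of_mem hr]
    have : Prod.mk r ⁻¹' (acceptSet ν f ψ k ∩ {z | ψ z.1 ∈ B}) =
        {u | ENNReal.ofReal u * surv ν f k < acc ν f k (ψ r)} := by
      ext u; simp [acceptSet, hr]
    rw [this]
    exact mul_volume_ofReal_mul_lt ((min_le_right _ _).trans (surv_anti hf1 (Nat.le_succ k)))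
      (surv_ne_top hf1 k)
  · have : Prod.mk r ⁻¹' (acceptSet ν f ψ k ∩ {z | ψ z.1 ∈ B}) = ∅ := by
      ext u; simp [hr]
    rw [this, Set.indicator_of_notMem hr, measure_empty, mul_zero]

omit [IsProbabilityMeasure ρ] in
lemma prod_one_sub_proposal_acceptSet (k : ℕ) :
    ∏ j ∈ Finset.range k, (1 - proposal ρ (acceptSet ν f ψ j)) = surv ν f k := by
  induction k with
  | zero => simp [surv_zero hf1]
  | succ k ih =>
    have h := surv_mul_proposal_acceptSet_inter hψ hρ hf1 hf k MeasurableSet.univ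
    simp only [Set.mem_univ, Set.ofPred_true, Set.inter_univ, Measure.restrict_univ] at h
    rw [Finset.prod_range_succ, ih, ENNReal.mul_sub fun _ _ => surv_ne_top hf1 k, mul_one, h]
    conv_lhs => rw [← lintegral_acc_add hf1 hf k]
    refine ENNReal.add_sub_cancel_left (ne_top_of_le_ne_top (surv_ne_top hf1 k) ?_)
    rw [← lintegral_acc_add hf1 hf k]
    exact le_self_add

lemma infinitePi_proposal_firstHitSet_inter (k : ℕ) {B : Set 𝓨} (hB : MeasurableSet B) :
    Measure.infinitePi (fun _ : ℕ => proposal ρ)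
      (firstHitSet (acceptSet ν f ψ) k ∩ {w | ψ (w k).1 ∈ B}) = ∫⁻ y in B, acc ν f k y ∂ν := by
  have h := infinitePi_firstHitSet_inter (proposal ρ) (measurableSet_acceptSet (ν := ν) hf hψ) k
    ((hψ.comp measurable_fst) hB)
  rw [prod_one_sub_proposal_acceptSet hψ hρ hf1 hf] at h
  exact h.trans (surv_mul_proposal_acceptSet_inter hψ hρ hf1 hf k hB)

lemma infinitePi_proposal_firstHitSet (k : ℕ) :
    Measure.infinitePi (fun _ : ℕ => proposal ρ) (firstHitSet (acceptSet ν f ψ) k) =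
      ∫⁻ y, acc ν f k y ∂ν := by
  simpa using infinitePi_proposal_firstHitSet_inter hψ hρ hf1 hf k MeasurableSet.univ

lemma lintegral_firstHit_acceptSet (φ : ℕ → ℝ≥0∞) :
    ∫⁻ w, φ (firstHit (acceptSet ν f ψ) w) ∂Measure.infinitePi (fun _ : ℕ => proposal ρ) =
      ∑' k, (∫⁻ y, acc ν f k y ∂ν) * φ k := by
  have hsum : ∑' k, Measure.infinitePi (fun _ : ℕ => proposal ρ)
      (firstHitSet (acceptSet ν f ψ) k) = 1 := by
    simp_rw [infinitePi_proposal_firstHitSet hψ hρ hf1 hf, tsum_lintegral_acc hf1 hf]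
  rw [lintegral_firstHit (measurableSet_acceptSet hf hψ) hsum fun k _ => φ k]
  refine tsum_congr fun k => ?_
  rw [setLIntegral_const, infinitePi_proposal_firstHitSet hψ hρ hf1 hf, mul_comm]

/-- The accepted sample has density `f`. -/
lemma infinitePi_proposal_sample_mem {B : Set 𝓨} (hB : MeasurableSet B)
    (hmeas : MeasurableSet {w : ℕ → ℝ × ℝ | ψ (w (firstHit (acceptSet ν f ψ) w)).1 ∈ B}) :
    Measure.infinitePi (fun _ : ℕ => proposal ρ)
      {w | ψ (w (firstHit (acceptSet ν f ψ) w)).1 ∈ B} = ∫⁻ y in B, f y ∂ν := by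
  have hsum : ∑' k, Measure.infinitePi (fun _ : ℕ => proposal ρ)
      (firstHitSet (acceptSet ν f ψ) k) = 1 := by
    simp_rw [infinitePi_proposal_firstHitSet hψ hρ hf1 hf, tsum_lintegral_acc hf1 hf]
  have hk : ∀ k : ℕ, MeasurableSet {w : ℕ → ℝ × ℝ | ψ (w k).1 ∈ B} := fun k =>
    (hψ.comp (measurable_fst.comp (measurable_pi_apply k))) hB
  rw [← tsum_setLIntegral_acc hf1 hf, ← lintegral_indicator_one hmeas]
  refine (lintegral_firstHit (measurableSet_acceptSet hf hψ) hsum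
    fun k w => {w : ℕ → ℝ × ℝ | ψ (w k).1 ∈ B}.indicator 1 w).trans ?_
  refine tsum_congr fun k => ?_
  rw [lintegral_indicator_one (hk k), Measure.restrict_apply (hk k), Set.inter_comm,
    infinitePi_proposal_firstHitSet_inter hψ hρ hf1 hf k hB]

end GreedySampler

/-! ### The simulation scheme and its law -/

namespace GreedySampler

variable {𝓧 𝓨 : Type*} [MeasurableSpace 𝓧] [MeasurableSpace 𝓨]

lemma measurable_firstHit_acceptSet {ν : Measure 𝓨} [SFinite ν] {F : 𝓧 × 𝓨 → ℝ≥0∞}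
    (hF : Measurable F) {ψ : ℝ → 𝓨} (hψ : Measurable ψ) :
    Measurable fun p : 𝓧 × (ℕ → ℝ × ℝ) => firstHit (acceptSet ν (fun y => F (p.1, y)) ψ) p.2 :=
  measurable_firstHit (A := fun x => acceptSet ν (fun y => F (x, y)) ψ)
    (measurableSet_acceptSet_prod hF hψ)

/-- Alice looks for the first accepted proposal and describes its index in the code `c`. -/
noncomputable def scheme (ν : Measure 𝓨) [SFinite ν] {F : 𝓧 × 𝓨 → ℝ≥0∞} (hF : Measurable F)
    (ρ : Measure ℝ) [IsProbabilityMeasure ρ] {ψ : ℝ → 𝓨} (hψ : Measurable ψ) {c : ℕ → List Bool}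
    (hc : ∀ j k, c j <+: c k → j = k) : SimulationScheme 𝓧 𝓨 (ℕ → ℝ × ℝ) where
  law := Measure.infinitePi fun _ => proposal ρ
  isProbabilityMeasure_law := inferInstance
  enc x w := c (firstHit (acceptSet ν (fun y => F (x, y)) ψ) w)
  dec m w := ψ (w (Function.invFun c m)).1
  measurableSet_enc m :=
    (MeasurableSet.of_discrete (s := {k | c k = m})).preimage (measurable_firstHit_acceptSet hF hψ)
  measurable_dec m := hψ.comp (measurable_fst.comp (measurable_pi_apply _))
  prefixFree w := by
    rintro _ ⟨x, rfl⟩ _ ⟨x', rfl⟩ h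
    exact congrArg c (hc _ _ h)

variable {ν : Measure 𝓨} [IsProbabilityMeasure ν] {F : 𝓧 × 𝓨 → ℝ≥0∞} (hF : Measurable F)
  {ρ : Measure ℝ} [IsProbabilityMeasure ρ] {ψ : ℝ → 𝓨} (hψ : Measurable ψ) (hρ : ρ.map ψ = ν)
  {c : ℕ → List Bool} (hc : ∀ j k, c j <+: c k → j = k)
  {μ : Measure 𝓧} [IsProbabilityMeasure μ] (hF1 : ∀ᵐ x ∂μ, ∫⁻ y, F (x, y) ∂ν = 1)
include hρ hF1

lemma scheme_jointLaw : (scheme ν hF ρ hψ hc).jointLaw μ = (μ.prod ν).withDensity F := by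
  set S := scheme ν hF ρ hψ hc with hS
  have := S.isProbabilityMeasure_law
  have : IsProbabilityMeasure (S.jointLaw μ) :=
    Measure.isProbabilityMeasure_map S.measurable_output.aemeasurable
  have hdec : ∀ x w, S.dec (S.enc x w) w =
      ψ (w (firstHit (acceptSet ν (fun y => F (x, y)) ψ) w)).1 := fun x w => by
    have : Function.Injective c := fun j k hjk => hc j k (hjk ▸ List.prefix_rfl)
    simp only [hS, scheme, Function.leftInverse_invFun this _]
  refine Measure.ext_prod fun {s} {t} hs ht => ?_
  have hm := S.measurable_output (hs.prod ht)
  rw [SimulationScheme.jointLaw, Measure.map_apply S.measurable_output (hs.prod ht),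
    Measure.prod_apply hm, withDensity_apply _ (hs.prod ht), ← Measure.prod_restrict,
    lintegral_prod _ hF.aemeasurable, ← lintegral_indicator hs]
  refine lintegral_congr_ae ?_
  filter_upwards [hF1] with x hx
  by_cases hxs : x ∈ s
  · rw [Set.indicator_of_mem hxs]
    have hset : Prod.mk x ⁻¹' ((fun p : 𝓧 × (ℕ → ℝ × ℝ) => (p.1, S.dec (S.enc p.1 p.2) p.2)) ⁻¹'
        s ×ˢ t) = {w | ψ (w (firstHit (acceptSet ν (fun y => F (x, y)) ψ) w)).1 ∈ t} := by
      ext w; simp [hxs, hdec]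
    rw [hset]
    refine infinitePi_proposal_sample_mem hψ hρ hx (hF.comp measurable_prodMk_left) ht ?_
    rw [← hset]
    exact measurable_prodMk_left hm
  · rw [Set.indicator_of_notMem hxs]
    have hset : Prod.mk x ⁻¹' ((fun p : 𝓧 × (ℕ → ℝ × ℝ) => (p.1, S.dec (S.enc p.1 p.2) p.2)) ⁻¹'
        s ×ˢ t) = ∅ := by
      ext w; simp [hxs]
    rw [hset, measure_empty]

omit [IsProbabilityMeasure μ] in
lemma scheme_expectedLength : (scheme ν hF ρ hψ hc).expectedLength μ =
    ∫⁻ x, ∑' k, (∫⁻ y, acc ν (fun y => F (x, y)) k y ∂ν) * ((c k).length : ℝ≥0∞) ∂μ := by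
  set S := scheme ν hF ρ hψ hc with hS
  have := S.isProbabilityMeasure_law
  rw [SimulationScheme.expectedLength, lintegral_prod]
  · refine lintegral_congr_ae ?_
    filter_upwards [hF1] with x hx
    exact lintegral_firstHit_acceptSet hψ hρ hx (hF.comp measurable_prodMk_left)
      fun k => ((c k).length : ℝ≥0∞)
  · refine Measurable.aemeasurable ?_
    exact (Measurable.of_discrete (f := fun k : ℕ => ((c k).length : ℝ≥0∞))).comp
      (measurable_firstHit_acceptSet hF hψ)

end GreedySampler

/-! ### The bound on standard Borel spaces -/

section

variable {𝓧 𝓨 : Type*} [MeasurableSpace 𝓧] [MeasurableSpace 𝓨]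

/-- Real-valued proposals put the common randomness in ℕ → ℝ × ℝ, a standard Borel space in `Type`,
whatever the universe of 𝓨. -/
lemma exists_real_measure_map_eq [StandardBorelSpace 𝓨] (ν : Measure 𝓨) [IsProbabilityMeasure ν] :
    ∃ (ρ : Measure ℝ) (ψ : ℝ → 𝓨), IsProbabilityMeasure ρ ∧ Measurable ψ ∧ ρ.map ψ = ν := by
  have : Nonempty 𝓨 := nonempty_of_isProbabilityMeasure ν
  have he := measurableEmbedding_embeddingReal 𝓨
  refine ⟨ν.map (embeddingReal 𝓨), he.invFun,
    Measure.isProbabilityMeasure_map he.measurable.aemeasurable, he.measurable_invFun, ?_⟩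
  rw [Measure.map_map he.measurable_invFun he.measurable, he.leftInverse_invFun.comp_eq_id,
    Measure.map_id]

lemma lintegral_rnDeriv_prod_eq_one {P : Measure (𝓧 × 𝓨)} [IsProbabilityMeasure P]
    (hP : P ≪ P.fst.prod P.snd) :
    ∀ᵐ x ∂P.fst, ∫⁻ y, P.rnDeriv (P.fst.prod P.snd) (x, y) ∂P.snd = 1 := by
  have hm := P.measurable_rnDeriv (P.fst.prod P.snd)
  refine ae_eq_of_forall_setLIntegral_eq_of_sigmaFinite hm.lintegral_prod_right' measurable_const
    fun s hs _ => ?_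
  have h := Measure.withDensity_rnDeriv_eq P _ hP
  rw [setLIntegral_one, Measure.fst_apply hs, ← Set.prod_univ]
  conv_rhs => rw [← h]
  rw [withDensity_apply _ (hs.prod .univ), ← Measure.prod_restrict,
    lintegral_prod _ hm.aemeasurable, Measure.restrict_univ]

/-- The expected length of the description of the index by a power law code. -/
lemma one_sub_logb_add_le {I : ℝ} (hI : 0 ≤ I) :
    1 - Real.logb 2 (1 / (I + 2)) + (1 + 1 / (I + 2)) * (I + 2) ≤ I + Real.logb 2 (I + 1) + 5 := by
  have h1 : Real.logb 2 (I + 2) ≤ 1 + Real.logb 2 (I + 1) := by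
    calc Real.logb 2 (I + 2) ≤ Real.logb 2 (2 * (I + 1)) :=
          (Real.logb_le_logb (by norm_num) (by linarith) (by linarith)).2 (by linarith)
      _ = _ := by rw [Real.logb_mul (by norm_num) (by linarith), Real.logb_self_eq_one (by norm_num)]
  have h2 : (1 + 1 / (I + 2)) * (I + 2) = I + 3 := by
    have : I + 2 ≠ 0 := by linarith
    field_simp; ring
  rw [one_div, Real.logb_inv, ← one_div, h2]
  linarith

/-- One-shot channel simulation on standard Borel spaces. -/
theorem exists_simulationScheme [StandardBorelSpace 𝓨] {P : Measure (𝓧 × 𝓨)}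
    [IsProbabilityMeasure P] (hP : mutualInfo P ≠ ∞) :
    ∃ S : SimulationScheme 𝓧 𝓨 (ℕ → ℝ × ℝ), S.jointLaw P.fst = P ∧
      S.expectedLength P.fst ≤ ENNReal.ofReal
        (mutualInfoBits P + Real.logb 2 (mutualInfoBits P + 1) + 5) := by
  have hac : P ≪ P.fst.prod P.snd := (InformationTheory.klDiv_ne_top_iff.1 hP).1
  obtain ⟨ρ, ψ, hρp, hψ, hρ⟩ := exists_real_measure_map_eq P.snd
  set F := P.rnDeriv (P.fst.prod P.snd)
  have hF : Measurable F := P.measurable_rnDeriv _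
  have hF1 := lintegral_rnDeriv_prod_eq_one hac
  set I := mutualInfoBits P with hI
  have hl2 : 0 < Real.log 2 := Real.log_pos (by norm_num)
  have hI0 : 0 ≤ I := div_nonneg ENNReal.toReal_nonneg hl2.le
  -- I + 2 bounds the mean of log₂(k + 3/2), so with this exponent the factor 1 + s costs exactly
  -- one extra bit.
  have hs : 0 < 1 / (I + 2) := by positivity
  set s := 1 / (I + 2) with hsdef
  obtain ⟨c, hc, hlen⟩ := exists_prefix_code_length_le hs
  refine ⟨GreedySampler.scheme P.snd hF ρ hψ hc, ?_, ?_⟩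
  · rw [GreedySampler.scheme_jointLaw hF hψ hρ hc hF1]
    exact Measure.withDensity_rnDeriv_eq P _ hac
  have hb : 0 ≤ 1 - Real.logb 2 s := by
    rw [hsdef, one_div, Real.logb_inv, sub_neg_eq_add]
    have := Real.logb_nonneg (b := 2) (by norm_num) (show (1 : ℝ) ≤ I + 2 by linarith)
    linarith
  set b := 1 - Real.logb 2 s with hbdef
  have hlog : ∀ k : ℕ, 0 ≤ Real.log (k + 3 / 2) := fun k =>
    Real.log_nonneg (by linarith [(Nat.cast_nonneg k : (0 : ℝ) ≤ k)])
  have hd : 0 ≤ (1 + s) / Real.log 2 := by positivity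
  -- The sampler bound is in nats; the division by log 2 converts to bits.
  set d := (1 + s) / Real.log 2 with hddef
  have hlen' : ∀ k, ((c k).length : ℝ≥0∞) ≤
      ENNReal.ofReal b + ENNReal.ofReal d * ENNReal.ofReal (Real.log (k + 3 / 2)) := by
    intro k
    rw [← ENNReal.ofReal_mul hd, ← ENNReal.ofReal_add hb (mul_nonneg hd (hlog k)),
      ← ENNReal.ofReal_natCast]
    refine ENNReal.ofReal_le_ofReal ((hlen k).trans_eq ?_)
    rw [Real.logb, hddef]
    ring
  have hkl : mutualInfo P = ∫⁻ x, ∫⁻ y, ENNReal.ofReal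
      (InformationTheory.klFun (F (x, y)).toReal) ∂P.snd ∂P.fst := by
    rw [mutualInfo, InformationTheory.klDiv_eq_lintegral_klFun_of_ac hac, lintegral_prod]
    exact ((InformationTheory.measurable_klFun.comp hF.ennreal_toReal).ennreal_ofReal).aemeasurable
  rw [GreedySampler.scheme_expectedLength hF hψ hρ hc hF1]
  calc ∫⁻ x, ∑' k, (∫⁻ y, GreedySampler.acc P.snd (fun y => F (x, y)) k y ∂P.snd) *
        ((c k).length : ℝ≥0∞) ∂P.fst
      ≤ ∫⁻ x, (ENNReal.ofReal d * (∫⁻ y, ENNReal.ofReal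
        (InformationTheory.klFun (F (x, y)).toReal) ∂P.snd) +
        (ENNReal.ofReal b + ENNReal.ofReal d * ENNReal.ofReal (2 * Real.log 2))) ∂P.fst := by
        refine lintegral_mono_ae ?_
        filter_upwards [hF1] with x hx
        have hFx : Measurable fun y => F (x, y) := hF.comp measurable_prodMk_left
        calc ∑' k, (∫⁻ y, GreedySampler.acc P.snd (fun y => F (x, y)) k y ∂P.snd) *
              ((c k).length : ℝ≥0∞)
            ≤ ∑' k : ℕ, ((∫⁻ y, GreedySampler.acc P.snd (fun y => F (x, y)) k y ∂P.snd) *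
                ENNReal.ofReal b + ENNReal.ofReal d *
                ((∫⁻ y, GreedySampler.acc P.snd (fun y => F (x, y)) k y ∂P.snd) *
                ENNReal.ofReal (Real.log (k + 3 / 2)))) := by
              refine ENNReal.tsum_le_tsum fun k => (mul_le_mul_right (hlen' k) _).trans_eq ?_
              ring
          _ ≤ ENNReal.ofReal b + ENNReal.ofReal d * (∫⁻ y, ENNReal.ofReal
                (InformationTheory.klFun (F (x, y)).toReal) ∂P.snd
                + ENNReal.ofReal (2 * Real.log 2)) := by
              rw [ENNReal.tsum_add, ENNReal.tsum_mul_right, ENNReal.tsum_mul_left,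
                GreedySampler.tsum_lintegral_acc hx hFx, one_mul]
              gcongr
              exact GreedySampler.tsum_acc_mul_log_le hx hFx
          _ = _ := by ring
    _ = ENNReal.ofReal d * mutualInfo P +
        (ENNReal.ofReal b + ENNReal.ofReal d * ENNReal.ofReal (2 * Real.log 2)) := by
        rw [lintegral_add_right _ measurable_const, lintegral_const, measure_univ, mul_one, hkl,
          lintegral_const_mul' _ _ ENNReal.ofReal_ne_top]
    _ = ENNReal.ofReal (b + (1 + s) * (I + 2)) := by
        rw [← ENNReal.ofReal_toReal hP, ← ENNReal.ofReal_mul hd, ← ENNReal.ofReal_mul hd,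
          ← ENNReal.ofReal_add hb (by positivity), ← ENNReal.ofReal_add (by positivity)
          (by positivity)]
        congr 1
        have : (mutualInfo P).toReal = I * Real.log 2 := by
          rw [hI, mutualInfoBits]; field_simp
        rw [this, hddef]
        field_simp
        ring
    _ ≤ _ := ENNReal.ofReal_le_ofReal (one_sub_logb_add_le hI0)

end

/-! ### Reducing the common randomness on finite alphabets -/

namespace SimulationScheme

variable {𝓧 𝓨 𝓦 : Type*} [MeasurableSpace 𝓧] [MeasurableSpace 𝓨] [MeasurableSpace 𝓦]

/-- Bob's output as a function of the input and of the common randomness. -/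
def output (S : SimulationScheme 𝓧 𝓨 𝓦) (w : 𝓦) (x : 𝓧) : 𝓨 :=
  S.dec (S.enc x w) w

/-- The expected length of the description when the common randomness is `w`. -/
noncomputable def lengthAt (S : SimulationScheme 𝓧 𝓨 𝓦) (μ : Measure 𝓧) (w : 𝓦) : ℝ≥0∞ :=
  ∫⁻ x, ((S.enc x w).length : ℝ≥0∞) ∂μ

lemma measurable_output_apply (S : SimulationScheme 𝓧 𝓨 𝓦) (x : 𝓧) :
    Measurable fun w => S.output w x :=
  (measurable_snd.comp S.measurable_output).comp (measurable_prodMk_left (x := x))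

lemma measurable_length (S : SimulationScheme 𝓧 𝓨 𝓦) :
    Measurable fun p : 𝓧 × 𝓦 => ((S.enc p.1 p.2).length : ℝ≥0∞) := by
  let _ : MeasurableSpace (List Bool) := ⊤
  have h : Measurable fun p : 𝓧 × 𝓦 => S.enc p.1 p.2 :=
    measurable_to_countable' fun m => S.measurableSet_enc m
  exact (measurable_from_top (f := fun m : List Bool => (m.length : ℝ≥0∞))).comp h

lemma measurable_lengthAt (S : SimulationScheme 𝓧 𝓨 𝓦) (μ : Measure 𝓧) [SFinite μ] :
    Measurable (S.lengthAt μ) :=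
  S.measurable_length.lintegral_prod_left'

lemma expectedLength_eq (S : SimulationScheme 𝓧 𝓨 𝓦) (μ : Measure 𝓧) [SFinite μ] :
    S.expectedLength μ = ∫⁻ w, S.lengthAt μ w ∂S.law := by
  have := S.isProbabilityMeasure_law
  exact lintegral_prod_symm _ S.measurable_length.aemeasurable

lemma jointLaw_singleton [MeasurableSingletonClass 𝓧] [MeasurableSingletonClass 𝓨]
    (S : SimulationScheme 𝓧 𝓨 𝓦) (μ : Measure 𝓧) [SFinite μ] (x : 𝓧) (y : 𝓨) :
    S.jointLaw μ {(x, y)} = μ {x} * S.law.map (fun w => S.output w x) {y} := by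
  have := S.isProbabilityMeasure_law
  rw [jointLaw, Measure.map_apply S.measurable_output (measurableSet_singleton _),
    Measure.map_apply (S.measurable_output_apply x) (measurableSet_singleton _),
    ← Measure.prod_prod]
  congr 1
  ext p
  simp only [Set.mem_preimage, Set.mem_singleton_iff, Prod.mk.injEq, Set.mem_prod, output]
  constructor
  · rintro ⟨rfl, h⟩; exact ⟨rfl, h⟩
  · rintro ⟨rfl, h⟩; exact ⟨rfl, h⟩

/-- The scheme that uses the values `v i` of the common randomness with the weights `b i`. -/
noncomputable def reindex [Countable 𝓧] [MeasurableSingletonClass 𝓧]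
    (S : SimulationScheme 𝓧 𝓨 𝓦) {n : ℕ} (v : Fin n → 𝓦) (b : Fin n → ℝ≥0∞)
    (hb : ∑ i, b i = 1) : SimulationScheme 𝓧 𝓨 (Fin n) where
  law := ∑ i, b i • Measure.dirac i
  isProbabilityMeasure_law := ⟨by simpa using hb⟩
  enc x i := S.enc x (v i)
  dec m i := S.dec m (v i)
  measurableSet_enc _ := MeasurableSet.of_discrete
  measurable_dec _ := Measurable.of_discrete
  prefixFree i := S.prefixFree (v i)

end SimulationScheme

/-- The total mass fixes the last atom, which saves one coordinate per input: hence |𝓨| - 1. -/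
lemma measure_eq_of_singleton_eq {𝓨 : Type*} [Finite 𝓨] [MeasurableSpace 𝓨]
    [MeasurableSingletonClass 𝓨] {p q : Measure 𝓨} [IsProbabilityMeasure p]
    [IsProbabilityMeasure q] (y₀ : 𝓨) (h : ∀ y ≠ y₀, p {y} = q {y}) : p = q := by
  classical
  have := Fintype.ofFinite 𝓨
  have key : ∀ r : Measure 𝓨, IsProbabilityMeasure r →
      r {y₀} = 1 - ∑ y ∈ Finset.univ.erase y₀, r {y} := by
    intro r _
    rw [sum_measure_singleton, ← prob_compl_eq_one_sub (Finset.measurableSet _)]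
    congr 1
    ext y; simp
  refine Measure.ext_of_singleton fun y => ?_
  by_cases hy : y = y₀
  · rw [hy, key p inferInstance, key q inferInstance]
    congr 1
    exact Finset.sum_congr rfl fun y hy => h y (Finset.ne_of_mem_erase hy)
  · exact h y hy

/-- On finite alphabets the common randomness can be reduced to a small finite set. -/
theorem SimulationScheme.exists_reindex {𝓧 𝓨 𝓦 : Type*} [Finite 𝓧] [Finite 𝓨] [Nonempty 𝓨]
    [MeasurableSpace 𝓧] [MeasurableSpace 𝓨] [MeasurableSpace 𝓦] [MeasurableSingletonClass 𝓧]
    [MeasurableSingletonClass 𝓨] (S : SimulationScheme 𝓧 𝓨 𝓦) (μ : Measure 𝓧)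
    [IsProbabilityMeasure μ] (hfin : S.expectedLength μ ≠ ∞) :
    ∃ (n : ℕ) (S' : SimulationScheme 𝓧 𝓨 (Fin n)), n ≤ Nat.card 𝓧 * (Nat.card 𝓨 - 1) + 2 ∧
      S'.jointLaw μ = S.jointLaw μ ∧ S'.expectedLength μ ≤ S.expectedLength μ := by
  classical
  have := Fintype.ofFinite 𝓧
  have := Fintype.ofFinite 𝓨
  have := S.isProbabilityMeasure_law
  let y₀ : 𝓨 := Classical.arbitrary 𝓨
  set a : (𝓧 → 𝓨) → ℝ≥0∞ := fun g => S.law (S.output ⁻¹' {g}) with ha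
  have hmeas : ∀ g : 𝓧 → 𝓨, MeasurableSet (S.output ⁻¹' {g}) := fun g =>
    (measurable_pi_lambda (fun w => S.output w) S.measurable_output_apply)
      (measurableSet_singleton g)
  have hatop : ∀ g, a g ≠ ∞ := fun g => measure_ne_top _ _
  have hℓ := S.measurable_lengthAt μ
  have hsum : ∑ g, a g = 1 := by
    rw [ha, sum_measure_preimage_singleton _ fun g _ => hmeas g]
    simp
  have hsumint : ∑ g, ∫⁻ w in S.output ⁻¹' {g}, S.lengthAt μ w ∂S.law = S.expectedLength μ := by
    rw [S.expectedLength_eq, ← lintegral_biUnion_finset _ fun g _ => hmeas g]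
    · have : ⋃ g ∈ (Finset.univ : Finset (𝓧 → 𝓨)), S.output ⁻¹' {g} = Set.univ := by
        ext w; simp
      rw [this, Measure.restrict_univ]
    · intro g _ g' _ hgg
      exact Set.disjoint_left.2 fun w hw hw' => hgg (hw.symm.trans hw')
  -- Among the w that produce the function g, some w has length at most the conditional average; it
  -- represents g.
  have hw : ∀ g, ∃ w, a g ≠ 0 → S.output w = g ∧
      S.lengthAt μ w * a g ≤ ∫⁻ w in S.output ⁻¹' {g}, S.lengthAt μ w ∂S.law := by
    intro g
    by_cases hg : a g = 0
    · have : Nonempty 𝓦 := nonempty_of_isProbabilityMeasure S.law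
      exact ⟨Classical.arbitrary 𝓦, fun h => absurd hg h⟩
    · obtain ⟨w, hw1, hw2⟩ := exists_le_setLAverage hg (hatop g) hℓ.aemeasurable
      refine ⟨w, fun _ => ⟨hw1, ?_⟩⟩
      rw [setLAverage_eq] at hw2
      exact (ENNReal.le_div_iff_mul_le (.inl hg) (.inl (hatop g))).1 hw2
  choose w hw using hw
  have hwtop : ∀ g, a g ≠ 0 → S.lengthAt μ (w g) ≠ ∞ := by
    intro g hg h
    have h1 := (hw g hg).2
    rw [h, ENNReal.top_mul hg, top_le_iff] at h1
    have h2 := Finset.single_le_sum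
      (f := fun g => ∫⁻ w in S.output ⁻¹' {g}, S.lengthAt μ w ∂S.law)
      (fun _ _ => zero_le) (Finset.mem_univ g)
    rw [hsumint] at h2
    exact hfin (top_le_iff.1 (h1 ▸ h2))
  -- The quantities to be preserved are linear in the law of g: the output probabilities off `y₀`
  -- for each input, and the mean length.
  let z : (𝓧 → 𝓨) → (𝓧 × {y // y ≠ y₀} → ℝ) × ℝ := fun g =>
    (fun p => if g p.1 = p.2 then 1 else 0, (S.lengthAt μ (w g)).toReal)
  -- Null functions are dropped: their `w g` is arbitrary, with possibly infinite length.
  set s : Finset (𝓧 → 𝓨) := Finset.univ.filter fun g => a g ≠ 0 with hs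
  have hmem : ∀ g ∈ s, a g ≠ 0 := fun g hg => (Finset.mem_filter.1 hg).2
  have hsum' : ∑ g ∈ s, (a g).toReal = 1 := by
    rw [← ENNReal.toReal_sum fun g _ => hatop g, hs, Finset.sum_filter_ne_zero, hsum,
      ENNReal.toReal_one]
  have hc : ∑ g ∈ s, (a g).toReal • z g ∈ convexHull ℝ (z '' s) :=
    (convex_convexHull ℝ _).sum_mem (fun g _ => ENNReal.toReal_nonneg) hsum'
      fun g hg => subset_convexHull ℝ _ ⟨g, hg, rfl⟩
  -- Carathéodory: affinely independent points number at most the dimension |𝓧|(|𝓨|-1)+1 plus one.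
  obtain ⟨ι, _, zι, b, hz, hind, hbpos, hbsum, hbz⟩ := eq_pos_convex_span_of_mem_convexHull hc
  have hz' : ∀ i, ∃ g ∈ s, z g = zι i := fun i => hz ⟨i, rfl⟩
  choose g hgs hgz using hz'
  have hcard : Fintype.card ι ≤ Nat.card 𝓧 * (Nat.card 𝓨 - 1) + 2 := by
    refine hind.card_le_finrank_succ.trans ((Nat.succ_le_succ (Submodule.finrank_le _)).trans ?_)
    rw [Module.finrank_prod, Module.finrank_fintype_fun_eq_card, Module.finrank_self,
      Fintype.card_prod, Fintype.card_subtype_compl, Fintype.card_subtype_eq, Nat.card_eq_fintype_card,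
      Nat.card_eq_fintype_card]
  let e := (Fintype.equivFin ι).symm
  have hb1 : ∑ i, ENNReal.ofReal (b (e i)) = 1 := by
    rw [← ENNReal.ofReal_sum_of_nonneg fun i _ => (hbpos _).le, e.sum_comp b, hbsum,
      ENNReal.ofReal_one]
  let S' := S.reindex (fun i => w (g (e i))) (fun i => ENNReal.ofReal (b (e i))) hb1
  have hout : ∀ i, S'.output i = g (e i) := fun i => (hw _ (hmem _ (hgs (e i)))).1
  refine ⟨_, S', hcard, ?_, ?_⟩
  · have := S'.isProbabilityMeasure_law
    refine Measure.ext_of_singleton fun ⟨x, y⟩ => ?_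
    rw [S.jointLaw_singleton, S'.jointLaw_singleton]
    congr 2
    have := Measure.isProbabilityMeasure_map (μ := S.law) (S.measurable_output_apply x).aemeasurable
    have := Measure.isProbabilityMeasure_map (μ := S'.law)
      (S'.measurable_output_apply x).aemeasurable
    refine measure_eq_of_singleton_eq y₀ fun y hy => ?_
    rw [Measure.map_apply (S.measurable_output_apply x) (measurableSet_singleton _),
      Measure.map_apply (S'.measurable_output_apply x) (measurableSet_singleton _)]
    have h1 : S.law ((fun w => S.output w x) ⁻¹' {y}) =
        ∑ g ∈ s, a g * ENNReal.ofReal (if g x = y then 1 else 0) := by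
      have h2 : (fun w => S.output w x) ⁻¹' {y} =
          S.output ⁻¹' (Finset.univ.filter fun g : 𝓧 → 𝓨 => g x = y : Finset (𝓧 → 𝓨)) := by
        ext w; simp
      rw [h2, ← sum_measure_preimage_singleton _ fun g _ => hmeas g, Finset.sum_filter, hs,
        Finset.sum_filter]
      refine Finset.sum_congr rfl fun g _ => ?_
      change (if g x = y then a g else 0) = _
      by_cases h : a g = 0
      · simp [h]
      · by_cases h' : g x = y <;> simp [h', h]
    have h3 : S'.law ((fun w => S'.output w x) ⁻¹' {y}) =
        ∑ i, ENNReal.ofReal (b (e i)) * ENNReal.ofReal (if g (e i) x = y then 1 else 0) := by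
      change (∑ i, ENNReal.ofReal (b (e i)) • Measure.dirac i : Measure (Fin _)) _ = _
      rw [Measure.finsetSum_apply]
      refine Finset.sum_congr rfl fun i _ => ?_
      rw [Measure.smul_apply, Measure.dirac_apply, smul_eq_mul]
      by_cases h' : g (e i) x = y <;> simp [h', hout]
    have h4 := congrArg (fun p => p.1 (x, ⟨y, hy⟩)) hbz
    simp only [Prod.fst_sum, Finset.sum_apply, Prod.smul_fst, Pi.smul_apply, smul_eq_mul,
      ← hgz, z] at h4
    rw [h1, h3, e.sum_comp (fun i => ENNReal.ofReal (b i) *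
      ENNReal.ofReal (if g i x = y then 1 else 0))]
    have hnn : ∀ g : 𝓧 → 𝓨, (0 : ℝ) ≤ if g x = y then 1 else 0 := fun g => by split_ifs <;> simp
    calc ∑ i, ENNReal.ofReal (b i) * ENNReal.ofReal (if g i x = y then 1 else 0)
        = ENNReal.ofReal (∑ i, b i * if g i x = y then 1 else 0) := by
          rw [ENNReal.ofReal_sum_of_nonneg fun i _ => mul_nonneg (hbpos i).le (hnn _)]
          exact Finset.sum_congr rfl fun i _ => (ENNReal.ofReal_mul (hbpos i).le).symm
      _ = ENNReal.ofReal (∑ g ∈ s, (a g).toReal * if g x = y then 1 else 0) := by rw [h4]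
      _ = _ := by
          rw [ENNReal.ofReal_sum_of_nonneg fun g _ => mul_nonneg ENNReal.toReal_nonneg (hnn _)]
          refine Finset.sum_congr rfl fun g _ => ?_
          rw [ENNReal.ofReal_mul ENNReal.toReal_nonneg, ENNReal.ofReal_toReal (hatop g)]
  · have h1 : S'.expectedLength μ = ∑ i, ENNReal.ofReal (b i) * S.lengthAt μ (w (g i)) := by
      rw [S'.expectedLength_eq, ← e.sum_comp]
      change ∫⁻ i, S'.lengthAt μ i ∂(∑ i, ENNReal.ofReal (b (e i)) • Measure.dirac i) = _
      rw [lintegral_finsetSum_measure]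
      refine Finset.sum_congr rfl fun i _ => ?_
      rw [lintegral_smul_measure, lintegral_dirac, smul_eq_mul]
      rfl
    have h4 := congrArg Prod.snd hbz
    simp only [Prod.snd_sum, Prod.smul_snd, smul_eq_mul, ← hgz, z] at h4
    calc S'.expectedLength μ = ENNReal.ofReal (∑ i, b i * (S.lengthAt μ (w (g i))).toReal) := by
          rw [h1, ENNReal.ofReal_sum_of_nonneg fun i _ =>
            mul_nonneg (hbpos i).le ENNReal.toReal_nonneg]
          refine Finset.sum_congr rfl fun i _ => ?_
          rw [ENNReal.ofReal_mul (hbpos i).le, ENNReal.ofReal_toReal (hwtop _ (hmem _ (hgs i)))]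
      _ = ENNReal.ofReal (∑ g ∈ s, (a g).toReal * (S.lengthAt μ (w g)).toReal) := by rw [h4]
      _ = ∑ g ∈ s, S.lengthAt μ (w g) * a g := by
          rw [ENNReal.ofReal_sum_of_nonneg fun g _ =>
            mul_nonneg ENNReal.toReal_nonneg ENNReal.toReal_nonneg]
          refine Finset.sum_congr rfl fun g hg => ?_
          rw [ENNReal.ofReal_mul ENNReal.toReal_nonneg, ENNReal.ofReal_toReal (hatop g),
            ENNReal.ofReal_toReal (hwtop g (hmem g hg)), mul_comm]
      _ ≤ ∑ g ∈ s, ∫⁻ w in S.output ⁻¹' {g}, S.lengthAt μ w ∂S.law :=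
          Finset.sum_le_sum fun g hg => (hw g (hmem g hg)).2
      _ ≤ ∑ g, ∫⁻ w in S.output ⁻¹' {g}, S.lengthAt μ w ∂S.law :=
          Finset.sum_le_sum_of_subset (Finset.subset_univ _)
      _ = S.expectedLength μ := hsumint

/-- An atom of P has mass at most that of either marginal, so P is absolutely continuous;
integrability is automatic on a finite space. -/
lemma mutualInfo_ne_top_of_finite {𝓧 𝓨 : Type*} [Finite 𝓧] [Finite 𝓨] [MeasurableSpace 𝓧]
    [MeasurableSpace 𝓨] [MeasurableSingletonClass 𝓧] [MeasurableSingletonClass 𝓨]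
    (P : Measure (𝓧 × 𝓨)) [IsProbabilityMeasure P] : mutualInfo P ≠ ∞ := by
  refine InformationTheory.klDiv_ne_top ?_ Integrable.of_finite
  intro t ht
  rw [← Set.biUnion_of_singleton t, measure_biUnion_null_iff t.to_countable]
  rintro ⟨x, y⟩ hxy
  have h : P.fst.prod P.snd ({x} ×ˢ {y}) = 0 :=
    measure_mono_null (by rw [Set.singleton_prod_singleton]; simpa using hxy) ht
  rw [Measure.prod_prod, mul_eq_zero, Measure.fst_apply (measurableSet_singleton x),
    Measure.snd_apply (measurableSet_singleton y)] at h
  rcases h with h | h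
  · exact measure_mono_null (by simp) h
  · exact measure_mono_null (by simp) h

/-! ### Assembly -/

theorem mainTheorem3 {𝓧 𝓨 : Type*}
    [MeasurableSpace 𝓧] [StandardBorelSpace 𝓧] [MeasurableSpace 𝓨] [StandardBorelSpace 𝓨]
    (μ : Measure 𝓧) [IsProbabilityMeasure μ] (κ : Kernel 𝓧 𝓨) [IsMarkovKernel κ] :
    (mutualInfo (μ.compProd κ) ≠ ∞ →
      ∃ (𝓦 : Type) (_ : MeasurableSpace 𝓦) (_ : StandardBorelSpace 𝓦)
        (S : SimulationScheme 𝓧 𝓨 𝓦),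
        S.Simulates μ κ ∧
        S.expectedLength μ ≤ ENNReal.ofReal (mutualInfoBits (μ.compProd κ)
          + Real.logb 2 (mutualInfoBits (μ.compProd κ) + 1) + 5)) ∧
    (Finite 𝓧 → Finite 𝓨 →
      mutualInfo (μ.compProd κ) ≠ ∞ ∧
      ∃ (𝓦 : Type) (_ : MeasurableSpace 𝓦) (_ : StandardBorelSpace 𝓦)
        (S : SimulationScheme 𝓧 𝓨 𝓦),
        S.Simulates μ κ ∧
        S.expectedLength μ ≤ ENNReal.ofReal (mutualInfoBits (μ.compProd κ)
          + Real.logb 2 (mutualInfoBits (μ.compProd κ) + 1) + 5) ∧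
        Finite 𝓦 ∧
        Real.logb 2 (Nat.card 𝓦) ≤
          Real.logb 2 ((Nat.card 𝓧 : ℝ) * ((Nat.card 𝓨 : ℝ) - 1) + 2)) := by
  have general : mutualInfo (μ.compProd κ) ≠ ∞ → ∃ S : SimulationScheme 𝓧 𝓨 (ℕ → ℝ × ℝ),
      S.jointLaw μ = μ.compProd κ ∧ S.expectedLength μ ≤ ENNReal.ofReal
        (mutualInfoBits (μ.compProd κ) + Real.logb 2 (mutualInfoBits (μ.compProd κ) + 1) + 5) := by
    intro h
    simpa only [Measure.fst_compProd] using exists_simulationScheme h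
  refine ⟨fun h => ?_, fun _ _ => ?_⟩
  · obtain ⟨S, hS, hlen⟩ := general h
    exact ⟨_, _, inferInstance, S, hS, hlen⟩
  · have hI := mutualInfo_ne_top_of_finite (μ.compProd κ)
    refine ⟨hI, ?_⟩
    obtain ⟨S, hS, hlen⟩ := general hI
    have : Nonempty 𝓨 := by
      have : Nonempty 𝓧 := nonempty_of_isProbabilityMeasure μ
      exact nonempty_of_isProbabilityMeasure (κ (Classical.arbitrary 𝓧))
    obtain ⟨n, S', hn, hS', hlen'⟩ :=
      S.exists_reindex μ (ne_top_of_le_ne_top ENNReal.ofReal_ne_top hlen)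
    refine ⟨Fin n, _, inferInstance, S', hS'.trans hS, hlen'.trans hlen, inferInstance, ?_⟩
    have hn0 : 0 < n := by
      have := S'.isProbabilityMeasure_law
      have : Nonempty (Fin n) := nonempty_of_isProbabilityMeasure S'.law
      exact Fin.pos_iff_nonempty.2 this
    -- Natural subtraction agrees with real subtraction here because 𝓨 is nonempty.
    have hcast : (n : ℝ) ≤ (Nat.card 𝓧 : ℝ) * ((Nat.card 𝓨 : ℝ) - 1) + 2 := by
      have h1 : (n : ℝ) ≤ ((Nat.card 𝓧 * (Nat.card 𝓨 - 1) + 2 : ℕ) : ℝ) := by exact_mod_cast hn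
      push_cast [Nat.cast_sub (Nat.card_pos (α := 𝓨))] at h1
      exact h1
    rw [Nat.card_fin]
    have hn0' : (0 : ℝ) < n := by exact_mod_cast hn0
    exact (Real.logb_le_logb (by norm_num) hn0' (hn0'.trans_le hcast)).2 hcast
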